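/- Let $X\subseteq\mathbb R^d$ be closed, bounded and convex, with non-empty interior and $C^2$ boundary, and let $n:\partial X\to\mathbb R^d$ be its outward unit normal. For $x\in X$ let $\mathrm{TC}_X(x)=\overline{\{\lambda(y-x): y\in X,\ \lambda\ge 0\}}$ be the tangent cone and $\Pi_{\mathrm{TC}_X(x)}$ the metric projection onto it. A continuous field $Q:X\to\mathbb R^d$ is called well-behaved if there is a unique continuous map $G:X\times[0,\infty)\to X$ such that for every $x_0\in X$ the trajectory $t\mapsto G(x_0,t)$ is absolutely continuous, $G(x_0,0)=x_0$, and $\frac{d}{dt}G(x_0,t)=\Pi_{\mathrm{TC}_X(G(x_0,t))}Q(G(x_0,t))$ for almost every $t$. Its dynamic solver is then $g_Q:X\to X\sqcup\{\dagger\}$, where $g_Q(x_0)=\lim_{t\to\infty}G(x_0,t)$ if this limit exists in $X$ and $g_Q(x_0)=\dagger$ otherwise; the image $g_Q(X)$ is the set of reachable terminal states. Let $\mathcal Q$ be a complete metric vector space (a real vector space with a complete metric for which the vector space operations are continuous) whose elements $Q$ are, or index, $C^1$ vector fields $X\to\mathbb R^d$. A set $S\subseteq\mathcal Q$ is prevalent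 if there is a finite-dimensional subspace $P\subseteq\mathcal Q$ such that for every $Q\in\mathcal Q$ the set $\{p\in P: Q+p\in S\}$ has full Lebesgue measure in $P$. For a finite-dimensional subspace $P\subseteq\mathcal Q$ and $Q\in\mathcal Q$ define $$e^{Q}:P\times X\to\mathbb R^d,\quad e^{Q}(p,x)=(Q+p)(x),\qquad e^{\tilde Q}:P\times\partial X\times[0,\infty)\to\mathbb R^d,\quad e^{\tilde Q}(p,x,\alpha)=(Q+p)(x)-\alpha\, n(x).$$ 1. Every $Q\in\mathcal Q$ is well-behaved. If there is a finite-dimensional subspace $P\subseteq\mathcal Q$ such that for every $Q\in\mathcal Q$ the maps $e^{Q}$ and $e^{\tilde Q}$ are $C^1$ submersions, then $|g_Q(X)|<\infty$ for prevalent $Q\in\mathcal Q$. 2. Suppose that the vector space operations of $\mathcal Q$ are the pointwise ones. If $P\subseteq\mathcal Q$ is a finite-dimensional subspace such that for every $x\in X$ the evaluation map $P\to\mathbb R^d$, $p\mapsto p(x)$, is a submersion, then $e^{Q}$ and $e^{\tilde Q}$ are $C^1$ submersions for every $Q\in\mathcal Q$. If $\mathcal Q$ contains all constant fields, then there is a finite-dimensional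 subspace $P$ as in 1, and hence $|g_Q(X)|<\infty$ for prevalent $Q\in\mathcal Q$. 3. The spaces $\{-\nabla f: f\in C^2(X,\mathbb R)\}$ (projected gradient flows) and $\{x\mapsto f(x)-x: f\in C^1(X,\mathbb R^d)\}$ (projected Picard flows), with the pointwise operations, consist of $C^1$ fields, are complete metric vector spaces under the $C^1$ distance $\sup_X\|Q-R\|+\sup_X\|DQ-DR\|$, and contain the constant fields; in each of them, $|g_Q(X)|<\infty$ for prevalent $Q$. -/

import Mathlib

open Set Filter Topology MeasureTheory
open scoped NNReal

namespace DynSolver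

noncomputable section

/-- `d`-dimensional Euclidean space. -/
abbrev Euc (d : ℕ) : Type := EuclideanSpace ℝ (Fin d)

/-! ## The domain -/

/-- The boundary of `X` is of class `C²`: near every boundary point, `X` is the sublevel set
`{ρ ≤ 0}` of a `C²` function `ρ` whose differential does not vanish at that point. -/
def HasC2Boundary {d : ℕ} (X : Set (Euc d)) : Prop :=
  ∀ x ∈ frontier X, ∃ (U : Set (Euc d)) (ρ : Euc d → ℝ),
    IsOpen U ∧ x ∈ U ∧ ContDiffOn ℝ 2 ρ U ∧ fderiv ℝ ρ x ≠ 0 ∧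
      X ∩ U = {y | ρ y ≤ 0} ∩ U

/-- The standing assumptions on the space `X` of possible solutions: closed and convex with
non-empty interior, and bounded with `C²` boundary. -/
structure IsC2ConvexBody {d : ℕ} (X : Set (Euc d)) : Prop where
  isClosed : IsClosed X
  convex : Convex ℝ X
  interior_nonempty : (interior X).Nonempty
  isBounded : Bornology.IsBounded X
  boundary : HasC2Boundary X

/-- The tangent cone to the convex set `X` at `x`. -/
def tangentCone {d : ℕ} (X : Set (Euc d)) (x : Euc d) : Set (Euc d) :=
  closure {v | ∃ y ∈ X, ∃ c : ℝ, 0 ≤ c ∧ v = c • (y - x)}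

/-- The normal cone to the convex set `X` at `x`. -/
def normalCone {d : ℕ} (X : Set (Euc d)) (x : Euc d) : Set (Euc d) :=
  {v | ∀ y ∈ X, inner ℝ v (y - x) ≤ 0}

/-- The outward unit normal `n(x)` at a boundary point `x`: the unit vector of the normal cone
(it exists and is unique when `X` is a convex body with `C²` boundary and `x ∈ ∂X`). -/
def outwardNormal {d : ℕ} (X : Set (Euc d)) (x : Euc d) : Euc d :=
  Classical.epsilon fun v => v ∈ normalCone X x ∧ ‖v‖ = 1

/-- The metric projection of `v` onto `K`, i.e. the point of `K` nearest to `v`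
(it exists and is unique when `K` is closed, convex and non-empty). -/
def metricProj {d : ℕ} (K : Set (Euc d)) (v : Euc d) : Euc d :=
  Classical.epsilon fun w => w ∈ K ∧ ∀ z ∈ K, ‖v - w‖ ≤ ‖v - z‖

/-! ## Projected dynamics and the dynamic solver -/

/-- The vector field `Q` projected onto the tangent cones of `X`. -/
def projectedField {d : ℕ} (X : Set (Euc d)) (Q : X → Euc d) (x : X) : Euc d :=
  metricProj (tangentCone X x) (Q x)

/-- `G : X × [0,∞) → X` is a continuous solution map of the projected autonomous system of `Q`:
every trajectory starts at its initial condition, is absolutely continuous, and solves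
`ẋ = Π_{TC_X(x)} Q(x)` for almost every time. -/
structure IsSolutionMap {d : ℕ} (X : Set (Euc d)) (Q : X → Euc d) (G : X × ℝ≥0 → X) : Prop where
  continuous : Continuous G
  init : ∀ x : X, G (x, 0) = x
  absCont : ∀ (x : X) (T : ℝ≥0),
    AbsolutelyContinuousOnInterval (fun t : ℝ => (G (x, t.toNNReal) : Euc d)) 0 T
  deriv : ∀ x : X, ∀ᵐ t ∂(volume.restrict (Ioi (0 : ℝ))),
    HasDerivAt (fun s : ℝ => (G (x, s.toNNReal) : Euc d))
      (projectedField X Q (G (x, t.toNNReal))) t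

/-- The projected dynamics of `Q` are well-behaved: there is exactly one solution map. -/
def WellBehaved {d : ℕ} (X : Set (Euc d)) (Q : X → Euc d) : Prop :=
  ∃! G : X × ℝ≥0 → X, IsSolutionMap X Q G

open Classical in
/-- The dynamic solver `g_Q : X → X ⊔ {†}` (with `† = none`), which sends an initial condition to
the limit of its trajectory if that limit exists in `X`, and to `†` otherwise. -/
def dynamicSolver {d : ℕ} (X : Set (Euc d)) (Q : X → Euc d) (h : WellBehaved X Q) (x₀ : X) :
    Option X :=
  if hl : ∃ y : X, Tendsto (fun t : ℝ≥0 => h.choose (x₀, t)) atTop (𝓝 y) then some hl.choose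
  else none

/-- The reachable terminal states of `g_Q`, that is, its image. -/
def reachableTerminalStates {d : ℕ} (X : Set (Euc d)) (Q : X → Euc d) (h : WellBehaved X Q) :
    Set (Option X) :=
  Set.range (dynamicSolver X Q h)

/-- `Q` induces a dynamic solver, and this solver has finitely many reachable terminal states. -/
def HasFinitelyManyRTS {d : ℕ} (X : Set (Euc d)) (Q : X → Euc d) : Prop :=
  ∃ h : WellBehaved X Q, (reachableTerminalStates X Q h).Finite

/-! ## Fields of class `C¹`, submersions -/

/-- Extension by zero of a field on `X`, so that calculus within `X` applies to it. -/
def extendField {d : ℕ} (X : Set (Euc d)) (Q : X → Euc d) : Euc d → Euc d :=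
  Function.extend Subtype.val Q 0

/-- The field `Q : X → ℝᵈ` is continuously differentiable (up to the boundary). -/
def IsC1Field {d : ℕ} (X : Set (Euc d)) (Q : X → Euc d) : Prop :=
  ContDiffOn ℝ 1 (extendField X Q) X

/-- `f : S → F` is a `C¹` submersion on a submanifold `S`, possibly with boundary, of a normed
space: it is `C¹` and its derivative at any `x ∈ S` maps the tangent space of `S` at `x`, which is
the linear span of the tangent directions of `S` at `x`, onto `F`. (The derivative within `S` is
determined on that span.) -/
def IsC1SubmersionOn {V F : Type*} [NormedAddCommGroup V] [NormedSpace ℝ V]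
    [NormedAddCommGroup F] [NormedSpace ℝ F] (f : V → F) (S : Set V) : Prop :=
  ContDiffOn ℝ 1 f S ∧ ∀ x ∈ S, ∃ f' : V →L[ℝ] F, HasFDerivWithinAt f f' S x ∧
    (Submodule.span ℝ (tangentConeAt ℝ S x)).map (f' : V →ₗ[ℝ] F) = ⊤

/-! ## Complete metric vector spaces, prevalence, perturbed evaluation maps -/

/-- The vector space `V` with the metric `m` is a complete metric vector space. -/
def IsCompleteMetricVectorSpace (V : Type*) [AddCommGroup V] [Module ℝ V] (m : MetricSpace V) :
    Prop :=
  letI : MetricSpace V := m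
  CompleteSpace V ∧ IsTopologicalAddGroup V ∧ ContinuousSMul ℝ V

/-- Linear coordinates on a finite-dimensional subspace `P`. Lebesgue null sets of `P` and `C¹`
maps on `P` do not depend on the choice of the coordinates. -/
def coords {V : Type*} [AddCommGroup V] [Module ℝ V] (P : Submodule ℝ V) [FiniteDimensional ℝ P] :
    (Fin (Module.finrank ℝ P) → ℝ) ≃ₗ[ℝ] P :=
  (Module.finBasis ℝ P).equivFun.symm

/-- `S` is prevalent: for some finite-dimensional subspace `P` and every `Q`, the set of all
`p ∈ P` with `Q + p ∈ S` has full Lebesgue measure in `P`. -/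
def Prevalent {V : Type*} [AddCommGroup V] [Module ℝ V] (S : Set V) : Prop :=
  ∃ (P : Submodule ℝ V) (_ : FiniteDimensional ℝ P), ∀ Q : V,
    ∀ᵐ c : Fin (Module.finrank ℝ P) → ℝ, Q + (coords P c : V) ∈ S

section Evaluation

variable {d : ℕ} {V : Type*} [AddCommGroup V] [Module ℝ V]

/-- The perturbed evaluation map `e^Q (p, x) = (Q + p)(x)`, to be considered on `P × X`; the field
on `X` that belongs to `Q : V` is `ev Q`. -/
def perturbedEval (X : Set (Euc d)) (ev : V → X → Euc d) (P : Submodule ℝ V)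
    [FiniteDimensional ℝ P] (Q : V) :
    (Fin (Module.finrank ℝ P) → ℝ) × Euc d → Euc d :=
  fun z => extendField X (ev (Q + (coords P z.1 : V))) z.2

/-- The perturbed evaluation map `e^Q̃ (p, x, α) = (Q + p)(x) - α n(x)`, to be considered on
`P × ∂X × [0,∞)`. -/
def perturbedEvalTilde (X : Set (Euc d)) (ev : V → X → Euc d) (P : Submodule ℝ V)
    [FiniteDimensional ℝ P] (Q : V) :
    (Fin (Module.finrank ℝ P) → ℝ) × Euc d × ℝ → Euc d :=
  fun z => extendField X (ev (Q + (coords P z.1 : V))) z.2.1 - z.2.2 • outwardNormal X z.2.1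

/-- For every `Q`, both perturbed evaluation maps with perturbations from `P` are `C¹`
submersions. -/
def IsSubmersionProbe (X : Set (Euc d)) (ev : V → X → Euc d) (P : Submodule ℝ V)
    [FiniteDimensional ℝ P] : Prop :=
  ∀ Q : V,
    IsC1SubmersionOn (perturbedEval X ev P Q) (univ ×ˢ X) ∧
    IsC1SubmersionOn (perturbedEvalTilde X ev P Q) (univ ×ˢ (frontier X ×ˢ Ici (0 : ℝ)))

/-- For every `x ∈ X`, the evaluation map `ev_x : P → ℝᵈ` is a submersion. -/
def EvalIsSubmersion (X : Set (Euc d)) (ev : V → X → Euc d) (P : Submodule ℝ V)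
    [FiniteDimensional ℝ P] : Prop :=
  ∀ x : X, IsC1SubmersionOn
    (fun c : Fin (Module.finrank ℝ P) → ℝ => ev (coords P c : V) x) univ

/-- All constant fields occur. -/
def ContainsConstants (X : Set (Euc d)) (ev : V → X → Euc d) : Prop :=
  ∀ u : Euc d, ∃ Q : V, ∀ x : X, ev Q x = u

end Evaluation

/-! ## Gradient flows and Picard flows -/

/-- The `C¹` distance of two fields. -/
def c1Dist {d : ℕ} (X : Set (Euc d)) (Q R : X → Euc d) : ℝ :=
  (⨆ x : X, ‖Q x - R x‖) +
    ⨆ x : X, ‖fderivWithin ℝ (extendField X Q) X x - fderivWithin ℝ (extendField X R) X x‖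

/-- The fields `-∇f` with `f ∈ C²(X, ℝ)`, with the pointwise operations. -/
def gradientFields {d : ℕ} (X : Set (Euc d)) : Submodule ℝ (X → Euc d) where
  carrier := {Q | ∃ f : Euc d → ℝ, ContDiffOn ℝ 2 f X ∧
    ∀ x : X, HasGradientWithinAt f (-Q x) X x}
  zero_mem' := ⟨fun _ => 0, contDiffOn_const, fun x => by
    simpa using hasGradientWithinAt_const (𝕜 := ℝ) (x : Euc d) X (0 : ℝ)⟩
  add_mem' := by
    rintro Q R ⟨f, hf, hf'⟩ ⟨g, hg, hg'⟩
    refine ⟨f + g, hf.add hg, fun x => ?_⟩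
    have h := (hf' x).hasFDerivWithinAt.add (hg' x).hasFDerivWithinAt
    rw [hasGradientWithinAt_iff_hasFDerivWithinAt]
    simpa [add_comm] using h
  smul_mem' := by
    rintro c Q ⟨f, hf, hf'⟩
    refine ⟨c • f, hf.const_smul c, fun x => ?_⟩
    have h := (hf' x).hasFDerivWithinAt.const_smul c
    rw [hasGradientWithinAt_iff_hasFDerivWithinAt]
    simpa using h

/-- The fields `x ↦ F(x) - x` with `F ∈ C¹(X, ℝᵈ)`, with the pointwise operations. -/
def picardFields {d : ℕ} (X : Set (Euc d)) : Submodule ℝ (X → Euc d) where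
  carrier := {Q | ∃ F : Euc d → Euc d, ContDiffOn ℝ 1 F X ∧ ∀ x : X, Q x = F x - x}
  zero_mem' := ⟨fun x => x, contDiffOn_id, fun x => by simp⟩
  add_mem' := by
    rintro Q R ⟨F, hF, hQ⟩ ⟨H, hH, hR⟩
    refine ⟨fun x => F x + H x - x, (hF.add hH).sub contDiffOn_id, fun x => ?_⟩
    change Q x + R x = F x + H x - x - x
    rw [hQ x, hR x]; abel
  smul_mem' := by
    rintro c Q ⟨F, hF, hQ⟩
    refine ⟨fun x => c • (F x - x) + x,
      ((hF.sub contDiffOn_id).const_smul c).add contDiffOn_id, fun x => ?_⟩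
    change c • Q x = c • (F x - x) + x - x
    rw [hQ x]; abel

/-- The space `W` of fields on `X` consists of `C¹` fields, is a complete metric vector space
under the `C¹` distance, and contains the constant fields. -/
def IsCompleteC1Class {d : ℕ} (X : Set (Euc d)) (W : Submodule ℝ (X → Euc d)) : Prop :=
  (∀ Q ∈ W, IsC1Field X Q) ∧
  (∃ m : MetricSpace W, (∀ Q R : W, m.dist Q R = c1Dist X Q R) ∧
    IsCompleteMetricVectorSpace W m) ∧
  ContainsConstants X (fun Q : W => (Q : X → Euc d))

end

end DynSolver

open DynSolver

/-! Well-posedness. The residual `Q x - Π Q x` lies in the normal cone at `x`, so in any pairing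
with `x - z`, `z ∈ X`, the projected field may be replaced by `Q` at the cost of an inequality
(`inner_projectedField_sub_le`). With a Lipschitz bound for `Q`, Grönwall's argument makes the flow
exponentially Lipschitz in the initial value (`IsTrajectory.norm_sub_le`), which gives uniqueness
and continuity. Existence comes from the projected Euler scheme: it satisfies an evolution
variational inequality with quadratic error, its limit along an ultrafilter inherits it
(`exists_curve`), and differentiating the inequality identifies the velocity as the projection
(`isTrajectory_of_curve`).

Reduction to equilibria. If a trajectory tends to `y`, then `Q y` is normal at `y`; otherwise the
squared distance to some `z ∈ X` would decrease at a fixed rate forever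
(`IsTrajectory.mem_normalCone_of_tendsto`). Hence it suffices that `Q x ∈ N_X(x)` has finitely many
solutions. Such an `x` is a zero of `Q` in the interior, or a boundary point with `Q x = α n(x)`, `α
≥ 0`.

Transversality. Both are square systems depending on a parameter `p ∈ P` and submersive in all
variables together. The zero set is locally parametrised by a space of the dimension of `P`, and
where a zero is degenerate in the space variables, the projection to `P` has singular derivative. So
the bad parameters form a null set by the equidimensional case of Sard's theorem, which needs no
more than `C¹` (`measure_fst_image_degenerate_zeros`). At the boundary the equation `ρ = 0` of a
local defining function is added, so that one works on convex subsets of a vector space rather than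
on `∂X` (`surjective_fderivWithin_boundary`). For the other parameters solutions are isolated, and
compactness leaves finitely many (`ae_finite_equilibria`).

Pointwise operations. The parameter directions alone give surjectivity once evaluation at each point
is onto, and constant fields in the coordinate directions achieve this. Completeness in the two
examples amounts to closedness under `C¹` limits. -/

namespace DynSolver

/-! ## Metric projections and tangent cones -/

section Projection

variable {d : ℕ} {K X : Set (Euc d)}

lemma metricProj_spec (hc : IsClosed K) (hv : Convex ℝ K) (hn : K.Nonempty) (u : Euc d) :
    metricProj K u ∈ K ∧
      ∀ w ∈ K, inner ℝ (u - metricProj K u) (w - metricProj K u) ≤ (0 : ℝ) := by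
  obtain ⟨v, hvK, hv'⟩ := exists_norm_eq_iInf_of_complete_convex hn hc.isComplete hv u
  have hbdd : BddBelow (range fun w : K => ‖u - w‖) :=
    ⟨0, forall_mem_range.2 fun _ => norm_nonneg _⟩
  have hex : ∃ w, w ∈ K ∧ ∀ z ∈ K, ‖u - w‖ ≤ ‖u - z‖ :=
    ⟨v, hvK, fun z hz => hv' ▸ ciInf_le hbdd (⟨z, hz⟩ : K)⟩
  have h : metricProj K u ∈ K ∧ ∀ z ∈ K, ‖u - metricProj K u‖ ≤ ‖u - z‖ :=
    Classical.epsilon_spec hex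
  refine ⟨h.1, (norm_eq_iInf_iff_real_inner_le_zero hv h.1).1 (le_antisymm ?_ ?_)⟩
  · have : Nonempty K := hn.to_subtype
    exact le_ciInf fun w => h.2 w w.2
  · exact ciInf_le hbdd (⟨_, h.1⟩ : K)

/-- Adding the two variational inequalities gives `‖a - b‖² ≤ ⟨u - v, a - b⟩`; Cauchy–Schwarz
finishes. This covers both nonexpansiveness of projections and, for `u = v`, their uniqueness. -/
lemma norm_sub_le_of_inner_le_zero {a b u v : Euc d}
    (h₁ : inner ℝ (u - a) (b - a) ≤ (0 : ℝ)) (h₂ : inner ℝ (v - b) (a - b) ≤ (0 : ℝ)) :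
    ‖a - b‖ ≤ ‖u - v‖ := by
  have h : ‖a - b‖ * ‖a - b‖ ≤ ‖u - v‖ * ‖a - b‖ := by
    refine le_trans ?_ (real_inner_le_norm (u - v) (a - b))
    rw [← real_inner_self_eq_norm_mul_norm]
    simp only [inner_sub_left, inner_sub_right] at *
    linarith [real_inner_comm a b]
  by_contra! hlt
  have hpos : 0 < ‖a - b‖ := lt_of_le_of_lt (norm_nonneg _) hlt
  exact absurd (le_of_mul_le_mul_right h hpos) (not_le.2 hlt)

lemma norm_metricProj_sub_le (hc : IsClosed K) (hv : Convex ℝ K) (hn : K.Nonempty)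
    (u v : Euc d) : ‖metricProj K u - metricProj K v‖ ≤ ‖u - v‖ :=
  norm_sub_le_of_inner_le_zero
    ((metricProj_spec hc hv hn u).2 _ (metricProj_spec hc hv hn v).1)
    ((metricProj_spec hc hv hn v).2 _ (metricProj_spec hc hv hn u).1)

lemma metricProj_eq (hc : IsClosed K) (hv : Convex ℝ K) {u a : Euc d} (ha : a ∈ K)
    (h : ∀ w ∈ K, inner ℝ (u - a) (w - a) ≤ (0 : ℝ)) : metricProj K u = a := by
  have hs := metricProj_spec hc hv ⟨a, ha⟩ u
  have := norm_sub_le_of_inner_le_zero (hs.2 a ha) (h _ hs.1)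
  rw [sub_self, norm_zero] at this
  exact sub_eq_zero.1 (norm_le_zero_iff.1 this)

lemma isClosed_tangentCone (x : Euc d) : IsClosed (tangentCone X x) := isClosed_closure

lemma convex_tangentCone (hX : Convex ℝ X) {x : Euc d} : Convex ℝ (tangentCone X x) := by
  refine Convex.closure ?_
  rintro _ ⟨y₁, hy₁, c₁, hc₁, rfl⟩ _ ⟨y₂, hy₂, c₂, hc₂, rfl⟩ a b ha hb -
  rcases (add_nonneg (mul_nonneg ha hc₁) (mul_nonneg hb hc₂)).eq_or_lt with h0 | hpos
  · have h1 : a * c₁ = 0 := by nlinarith [mul_nonneg ha hc₁, mul_nonneg hb hc₂]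
    have h2 : b * c₂ = 0 := by nlinarith [mul_nonneg ha hc₁, mul_nonneg hb hc₂]
    exact ⟨y₁, hy₁, 0, le_rfl, by simp [smul_smul, h1, h2]⟩
  -- A combination of two rays is one ray: total weight `s`, aimed at the weighted mean of the two
  -- targets.
  · set s := a * c₁ + b * c₂ with hs
    refine ⟨(a * c₁ / s) • y₁ + (b * c₂ / s) • y₂,
      hX hy₁ hy₂ (by positivity) (by positivity) ?_, s, hpos.le, ?_⟩
    · rw [← add_div, div_self hpos.ne']
    · rw [smul_sub s, smul_add, smul_smul s, smul_smul s, mul_div_cancel₀ _ hpos.ne',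
        mul_div_cancel₀ _ hpos.ne', hs]
      module

lemma smul_sub_mem_tangentCone {x y : Euc d} (hy : y ∈ X) {c : ℝ} (hc : 0 ≤ c) :
    c • (y - x) ∈ tangentCone X x := subset_closure ⟨y, hy, c, hc, rfl⟩

lemma smul_mem_tangentCone {x v : Euc d} (hv : v ∈ tangentCone X x) {c : ℝ} (hc : 0 ≤ c) :
    c • v ∈ tangentCone X x := by
  refine map_mem_closure (continuous_const_smul c) hv ?_
  rintro _ ⟨y, hy, b, hb, rfl⟩
  exact ⟨y, hy, c * b, mul_nonneg hc hb, smul_smul _ _ _⟩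

lemma add_mem_tangentCone (hX : Convex ℝ X) {x v w : Euc d} (hv : v ∈ tangentCone X x)
    (hw : w ∈ tangentCone X x) : v + w ∈ tangentCone X x := by
  have h := smul_mem_tangentCone (convex_tangentCone hX hv hw (a := 1 / 2) (b := 1 / 2)
    (by norm_num) (by norm_num) (by norm_num)) (c := 2) (by norm_num)
  rw [smul_add, smul_smul, smul_smul] at h
  norm_num at h
  exact h

lemma inner_le_zero_of_mem_tangentCone {x v w : Euc d}
    (h : ∀ z ∈ X, inner ℝ v (z - x) ≤ (0 : ℝ)) (hw : w ∈ tangentCone X x) :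
    inner ℝ v w ≤ (0 : ℝ) := by
  have hcl : IsClosed {w : Euc d | inner ℝ v w ≤ (0 : ℝ)} :=
    isClosed_le (by fun_prop) continuous_const
  refine closure_minimal ?_ hcl hw
  rintro _ ⟨y, hy, c, hc, rfl⟩
  rw [mem_ofPred_eq, inner_smul_right]
  exact mul_nonpos_of_nonneg_of_nonpos hc (h y hy)

/-- The cone is closed under addition, so the projection plus `z - x` is an admissible test point in
its variational inequality. -/
lemma inner_sub_metricProj_tangentCone_le (hX : Convex ℝ X) {x z : Euc d} (hx : x ∈ X)
    (hz : z ∈ X) (u : Euc d) :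
    inner ℝ (u - metricProj (tangentCone X x) u) (z - x) ≤ (0 : ℝ) := by
  have h0 : (0 : Euc d) ∈ tangentCone X x := by
    simpa using smul_sub_mem_tangentCone (X := X) (x := x) hx le_rfl
  have h := metricProj_spec (isClosed_tangentCone x) (convex_tangentCone hX) ⟨0, h0⟩ u
  have hz' : z - x ∈ tangentCone X x := by
    simpa using smul_sub_mem_tangentCone (X := X) (x := x) hz zero_le_one
  simpa using h.2 _ (add_mem_tangentCone hX h.1 hz')

/-- Because `-v` is in the cone too, every `w - v` is again a tangent vector, so normality of `u -
v` is already the full variational inequality. Velocities of curves in `X` are two-sided tangents,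
so this applies to them. -/
lemma metricProj_tangentCone_eq (hX : Convex ℝ X) {x u v : Euc d}
    (hv : v ∈ tangentCone X x) (hv' : -v ∈ tangentCone X x)
    (h : ∀ z ∈ X, inner ℝ (u - v) (z - x) ≤ (0 : ℝ)) : metricProj (tangentCone X x) u = v := by
  refine metricProj_eq (isClosed_tangentCone x) (convex_tangentCone hX) hv fun w hw => ?_
  have := inner_le_zero_of_mem_tangentCone h (add_mem_tangentCone hX hw hv')
  rwa [← sub_eq_add_neg] at this

end Projection

/-! ## Absolutely continuous functions -/

section AbsolutelyContinuous

variable {Y Z : Type*} [PseudoMetricSpace Y] [PseudoMetricSpace Z]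

lemma absolutelyContinuousOnInterval_of_dist_le {f : ℝ → Y} {g : ℝ → Z} {a b C : ℝ}
    (hf : AbsolutelyContinuousOnInterval f a b)
    (h : ∀ s t, dist (g s) (g t) ≤ C * dist (f s) (f t)) :
    AbsolutelyContinuousOnInterval g a b := by
  have h' := Filter.Tendsto.const_mul C (show Tendsto _ _ _ from hf)
  rw [mul_zero] at h'
  refine squeeze_zero (fun _ => Finset.sum_nonneg fun _ _ => dist_nonneg) (fun E => ?_) h'
  rw [Finset.mul_sum]
  exact Finset.sum_le_sum fun i _ => h _ _

lemma sub_le_mul_of_ae_deriv_le {f : ℝ → ℝ} {a b c : ℝ} (hab : a ≤ b)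
    (hf : AbsolutelyContinuousOnInterval f a b)
    (h : ∀ᵐ t, t ∈ Ioc a b → deriv f t ≤ c) : f b - f a ≤ c * (b - a) := by
  rw [← hf.integral_deriv_eq_sub]
  have hi : ∫ _ in a..b, c = c * (b - a) := by simp [mul_comm]
  rw [← hi]
  refine intervalIntegral.integral_mono_ae_restrict hab hf.intervalIntegrable_deriv
    intervalIntegrable_const ?_
  rw [← Measure.restrict_congr_set Ioc_ae_eq_Icc]
  exact (ae_restrict_iff' measurableSet_Ioc).2 h

end AbsolutelyContinuous

/-! ## Trajectories of the projected dynamics -/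

/-- `u` is an absolutely continuous solution of the projected dynamics of `Q`. -/
structure IsTrajectory {d : ℕ} (X : Set (Euc d)) (Q : X → Euc d) (u : ℝ≥0 → X) : Prop where
  absCont : ∀ T : ℝ≥0, AbsolutelyContinuousOnInterval (fun t : ℝ => (u t.toNNReal : Euc d)) 0 T
  deriv : ∀ᵐ t ∂(volume.restrict (Ioi (0 : ℝ))),
    HasDerivAt (fun s : ℝ => (u s.toNNReal : Euc d)) (projectedField X Q (u t.toNNReal)) t

section Trajectory

variable {d : ℕ} {X : Set (Euc d)} {Q : X → Euc d}

lemma IsSolutionMap.isTrajectory {G : X × ℝ≥0 → X} (h : IsSolutionMap X Q G) (x : X) :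
    IsTrajectory X Q fun t => G (x, t) := ⟨h.absCont x, h.deriv x⟩

lemma absolutelyContinuous_norm_sq {f : ℝ → Euc d} {R a b : ℝ} (hR : ∀ t, ‖f t‖ ≤ R)
    (hf : AbsolutelyContinuousOnInterval f a b) :
    AbsolutelyContinuousOnInterval (fun t => ‖f t‖ ^ 2) a b := by
  refine absolutelyContinuousOnInterval_of_dist_le (C := 2 * R) hf fun s t => ?_
  rw [Real.dist_eq, dist_eq_norm, sq_sub_sq, abs_mul]
  have h1 := abs_norm_sub_norm_le (f s) (f t)
  have h2 : |‖f s‖ + ‖f t‖| ≤ 2 * R := by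
    rw [abs_of_nonneg (by positivity)]; linarith [hR s, hR t]
  exact mul_le_mul h2 h1 (abs_nonneg _) ((abs_nonneg _).trans h2)

lemma ae_of_mem_Ioc {p : ℝ → Prop} (h : ∀ᵐ t ∂(volume.restrict (Ioi (0 : ℝ))), p t) {a b : ℝ}
    (ha : 0 ≤ a) : ∀ᵐ t, t ∈ Ioc a b → p t := by
  filter_upwards [(ae_restrict_iff' measurableSet_Ioi).1 h] with t ht htab
  exact ht (ha.trans_lt htab.1)

lemma inner_projectedField_sub_le (hX : Convex ℝ X) (x z : X) :
    inner ℝ (projectedField X Q x) ((x : Euc d) - z) ≤ inner ℝ (Q x) ((x : Euc d) - z) := by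
  have h := inner_sub_metricProj_tangentCone_le hX x.2 z.2 (Q x)
  simp only [projectedField, inner_sub_left, inner_sub_right] at *
  linarith

lemma exists_norm_sub_le (hb : Bornology.IsBounded X) :
    ∃ D : ℝ, 0 ≤ D ∧ ∀ x y : X, ‖(x : Euc d) - y‖ ≤ D :=
  ⟨Metric.diam X, Metric.diam_nonneg, fun x y => by
    rw [← dist_eq_norm]; exact Metric.dist_le_diam_of_mem hb x.2 y.2⟩

lemma IsTrajectory.norm_sub_le {u v : ℝ≥0 → X} (hX : Convex ℝ X) (hb : Bornology.IsBounded X)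
    {L : ℝ} (hL : ∀ x y : X, ‖Q x - Q y‖ ≤ L * ‖(x : Euc d) - y‖)
    (hu : IsTrajectory X Q u) (hv : IsTrajectory X Q v) (T : ℝ≥0) :
    ‖(u T : Euc d) - v T‖ ≤ Real.exp (L * T) * ‖(u 0 : Euc d) - v 0‖ := by
  obtain ⟨D, -, hD⟩ := exists_norm_sub_le hb
  set w : ℝ → Euc d := fun t => (u t.toNNReal : Euc d) - v t.toNNReal with hw
  have hac : AbsolutelyContinuousOnInterval (fun t => ‖w t‖ ^ 2) 0 T :=
    absolutelyContinuous_norm_sq (fun t => hD _ _) ((hu.absCont T).sub (hv.absCont T))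
  -- Integrating factor: `exp (-2Lt) ‖u - v‖²` is absolutely continuous with derivative at most `0`
  -- almost everywhere.
  have hexp : AbsolutelyContinuousOnInterval (fun t : ℝ => Real.exp (-(2 * L) * t)) 0 T :=
    ContDiffOn.absolutelyContinuousOnInterval (by fun_prop)
  have key := sub_le_mul_of_ae_deriv_le (c := 0) T.coe_nonneg (hexp.mul hac) (by
    filter_upwards [ae_of_mem_Ioc hu.deriv (le_refl (0:ℝ)), ae_of_mem_Ioc hv.deriv (le_refl (0:ℝ))]
      with t h1 h2 ht
    have hd := ((h1 ht).sub (h2 ht)).norm_sq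
    have he : HasDerivAt (fun t : ℝ => Real.exp (-(2 * L) * t))
        (Real.exp (-(2 * L) * t) * (-(2 * L))) t := by
      simpa using ((hasDerivAt_id t).const_mul (-(2 * L))).exp
    have hm : HasDerivAt ((fun t : ℝ => Real.exp (-(2 * L) * t)) * fun t => ‖w t‖ ^ 2) _ t :=
      he.mul hd
    rw [hm.deriv]
    set x := u t.toNNReal
    set y := v t.toNNReal
    have i1 := inner_projectedField_sub_le (Q := Q) hX x y
    have i2 := inner_projectedField_sub_le (Q := Q) hX y x
    have i3 : inner ℝ (Q x - Q y) ((x : Euc d) - y) ≤ L * ‖(x : Euc d) - y‖ ^ 2 := by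
      refine (real_inner_le_norm _ _).trans ?_
      nlinarith [hL x y, norm_nonneg ((x : Euc d) - y)]
    have i4 : inner ℝ ((x : Euc d) - y) (projectedField X Q x - projectedField X Q y)
        ≤ L * ‖(x : Euc d) - y‖ ^ 2 := by
      refine le_trans ?_ i3
      rw [real_inner_comm]
      simp only [inner_sub_left, inner_sub_right] at *
      linarith
    have hpos := Real.exp_pos (-(2 * L) * t)
    have hwt : w t = (x : Euc d) - y := rfl
    simp only [hwt]
    simp only [Pi.sub_apply]
    have := mul_le_mul_of_nonneg_left i4 hpos.le
    linarith)
  simp only [Pi.mul_apply, mul_zero, Real.exp_zero, one_mul, zero_mul, sub_nonpos] at key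
  simp only [hw, Real.toNNReal_coe, Real.toNNReal_zero] at key
  have hsq : ‖(u T : Euc d) - v T‖ ^ 2 ≤ (Real.exp (L * T) * ‖(u 0 : Euc d) - v 0‖) ^ 2 := by
    have h1 : Real.exp (L * T) ^ 2 * Real.exp (-(2 * L) * T) = 1 := by
      rw [← Real.exp_nat_mul, ← Real.exp_add]; simp; ring
    rw [mul_pow]
    have := mul_le_mul_of_nonneg_left key (sq_nonneg (Real.exp (L * T)))
    rwa [← mul_assoc, h1, one_mul] at this
  exact le_of_sq_le_sq hsq (by positivity)

lemma IsTrajectory.mem_normalCone_of_tendsto {u : ℝ≥0 → X} {y : X} (hX : Convex ℝ X)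
    (hb : Bornology.IsBounded X) (hQ : Continuous Q) (hu : IsTrajectory X Q u)
    (hy : Tendsto u atTop (𝓝 y)) : Q y ∈ normalCone X y := by
  intro z hz
  by_contra! hlt
  obtain ⟨D, -, hD⟩ := exists_norm_sub_le hb
  set δ : ℝ := inner ℝ (Q y) (z - y) with hδ
  have hlim : Tendsto (fun t => (inner ℝ (Q (u t)) ((u t : Euc d) - z) : ℝ)) atTop
      (𝓝 (inner ℝ (Q y) ((y : Euc d) - z))) := by
    have hc : Continuous fun x : X => (inner ℝ (Q x) ((x : Euc d) - z) : ℝ) := by fun_prop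
    exact (hc.tendsto y).comp hy
  have hyz : (inner ℝ (Q y) ((y : Euc d) - z) : ℝ) = -δ := by
    rw [hδ, ← inner_neg_right, neg_sub]
  rw [hyz] at hlim
  -- After `t₀` the pairing stays below `-δ / 2`, so `‖u - z‖²` has derivative at most `-δ`.
  obtain ⟨t₀, ht₀⟩ := eventually_atTop.1 (hlim.eventually (gt_mem_nhds (show -δ < -δ / 2 by linarith)))
  have hstep : ∀ b : ℝ≥0, t₀ ≤ b → -(D ^ 2) ≤ -δ * (b - t₀) := by
    intro b hbt
    have hac : AbsolutelyContinuousOnInterval (fun t : ℝ => ‖(u t.toNNReal : Euc d) - z‖ ^ 2) 0 b :=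
      absolutelyContinuous_norm_sq (fun t => hD _ ⟨z, hz⟩)
        (absolutelyContinuousOnInterval_of_dist_le (C := 1) (hu.absCont b) fun s t => by simp)
    have hac' := hac.mono (c := t₀) (d := b) (by
      rw [uIcc_of_le b.coe_nonneg, uIcc_of_le (by exact_mod_cast hbt)]
      exact Icc_subset_Icc t₀.coe_nonneg le_rfl)
    have key := sub_le_mul_of_ae_deriv_le (c := -δ) (by exact_mod_cast hbt) hac' (by
      filter_upwards [ae_of_mem_Ioc hu.deriv t₀.coe_nonneg] with t h1 ht
      have hd := ((h1 ht).sub_const z).norm_sq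
      rw [hd.deriv]
      have i1 := inner_projectedField_sub_le (Q := Q) hX (u t.toNNReal) ⟨z, hz⟩
      have i2 := ht₀ t.toNNReal (NNReal.le_toNNReal_of_coe_le ht.1.le)
      rw [real_inner_comm]
      simp only at i1
      linarith)
    have h1 : ‖(u t₀ : Euc d) - z‖ ^ 2 ≤ D ^ 2 :=
      pow_le_pow_left₀ (norm_nonneg _) (hD _ ⟨z, hz⟩) 2
    simp only [Real.toNNReal_coe] at key
    nlinarith [sq_nonneg ‖(u b : Euc d) - z‖]
  -- Over this time span the squared distance would drop by `D² + 1`, more than its largest possible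
  -- value `D²`.
  have := hstep (t₀ + (((D ^ 2 + 1) / δ).toNNReal)) le_self_add
  rw [NNReal.coe_add, add_sub_cancel_left, Real.coe_toNNReal _ (by positivity), neg_mul,
    mul_div_cancel₀ _ hlt.ne'] at this
  linarith

end Trajectory

/-! ## The projected Euler scheme -/

section Euler

variable {d : ℕ} {X : Set (Euc d)} {Q : X → Euc d}

/-- One step of size `h` of the projected Euler scheme. -/
noncomputable def eulerStep (hc : IsClosed X) (hv : Convex ℝ X) (Q : X → Euc d) (h : ℝ) (x : X) :
    X :=
  ⟨metricProj X ((x : Euc d) + h • Q x), (metricProj_spec hc hv ⟨x, x.2⟩ _).1⟩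

lemma norm_eulerStep_sub_le (hc : IsClosed X) (hv : Convex ℝ X) (h : ℝ) (x y : X) :
    ‖(eulerStep hc hv Q h x : Euc d) - y‖ ≤ ‖(x : Euc d) + h • Q x - y‖ := by
  have hy : metricProj X (y : Euc d) = y := metricProj_eq hc hv y.2 (by simp)
  have := norm_metricProj_sub_le hc hv ⟨x, x.2⟩ ((x : Euc d) + h • Q x) y
  rwa [hy] at this

lemma norm_iterate_eulerStep_sub_self_le (hc : IsClosed X) (hv : Convex ℝ X) {h M : ℝ}
    (hh : 0 ≤ h) (hM : ∀ x, ‖Q x‖ ≤ M) (j : ℕ) (x : X) :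
    ‖((eulerStep hc hv Q h)^[j] x : Euc d) - x‖ ≤ (h * j) * M := by
  induction j with
  | zero => simp
  | succ j ih =>
    rw [Function.iterate_succ_apply']
    set z := (eulerStep hc hv Q h)^[j] x
    have h1 : ‖(eulerStep hc hv Q h z : Euc d) - z‖ ≤ h * M := by
      refine (norm_eulerStep_sub_le hc hv h z z).trans ?_
      rw [add_sub_cancel_left, norm_smul, Real.norm_of_nonneg hh]
      exact mul_le_mul_of_nonneg_left (hM z) hh
    have := norm_sub_le_norm_sub_add_norm_sub (eulerStep hc hv Q h z : Euc d) z x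
    push_cast
    linarith

/-- Expanding the square, each step contributes `2h⟨Q z, z - y⟩ + h²M²` at the current iterate `z`.
Moving the pairing from `z` back to `x` costs `(LD + M) · hjM`, because `z` is within `hjM` of `x`.
Both errors fit into the increment `h²(2j + 1)` of `(hj)²`. -/
lemma norm_iterate_eulerStep_sub_sq_le (hc : IsClosed X) (hv : Convex ℝ X) {h M L D : ℝ}
    (hh : 0 ≤ h) (hM0 : 0 ≤ M) (hL0 : 0 ≤ L) (hM : ∀ x, ‖Q x‖ ≤ M)
    (hL : ∀ x y : X, ‖Q x - Q y‖ ≤ L * ‖(x : Euc d) - y‖) (hD : ∀ x y : X, ‖(x : Euc d) - y‖ ≤ D)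
    (j : ℕ) (x y : X) :
    ‖((eulerStep hc hv Q h)^[j] x : Euc d) - y‖ ^ 2 ≤ ‖(x : Euc d) - y‖ ^ 2 +
      2 * (h * j) * inner ℝ (Q x) ((x : Euc d) - y) + ((L * D + M) * M + M ^ 2) * (h * j) ^ 2 := by
  induction j with
  | zero => simp
  | succ j ih =>
    rw [Function.iterate_succ_apply']
    set z := (eulerStep hc hv Q h)^[j] x with hz
    have h1 : ‖(eulerStep hc hv Q h z : Euc d) - y‖ ^ 2 ≤
        ‖(z : Euc d) - y‖ ^ 2 + 2 * h * inner ℝ (Q z) ((z : Euc d) - y) + h ^ 2 * M ^ 2 := by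
      refine (pow_le_pow_left₀ (norm_nonneg _) (norm_eulerStep_sub_le hc hv h z y) 2).trans ?_
      rw [show (z : Euc d) + h • Q z - y = ((z : Euc d) - y) + h • Q z by abel,
        norm_add_sq_real, norm_smul, inner_smul_right, mul_pow, Real.norm_of_nonneg hh,
        real_inner_comm]
      have := pow_le_pow_left₀ (norm_nonneg _) (hM z) 2
      nlinarith [mul_le_mul_of_nonneg_left this (sq_nonneg h)]
    have h2 : (inner ℝ (Q z) ((z : Euc d) - y) : ℝ) ≤
        inner ℝ (Q x) ((x : Euc d) - y) + (L * D + M) * ((h * j) * M) := by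
      have e : (inner ℝ (Q z) ((z : Euc d) - y) : ℝ) - inner ℝ (Q x) ((x : Euc d) - y) =
          inner ℝ (Q z - Q x) ((z : Euc d) - y) + inner ℝ (Q x) ((z : Euc d) - x) := by
        simp only [inner_sub_left, inner_sub_right]; ring
      have hzx := norm_iterate_eulerStep_sub_self_le hc hv hh hM j x
      rw [← hz] at hzx
      have i1 : inner ℝ (Q z - Q x) ((z : Euc d) - y) ≤ (L * ‖(z : Euc d) - x‖) * D :=
        (real_inner_le_norm _ _).trans
          (mul_le_mul (hL z x) (hD z y) (norm_nonneg _) (by positivity))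
      have i2 : inner ℝ (Q x) ((z : Euc d) - x) ≤ M * ‖(z : Euc d) - x‖ :=
        (real_inner_le_norm _ _).trans (mul_le_mul_of_nonneg_right (hM x) (norm_nonneg _))
      have hD0 : 0 ≤ D := (norm_nonneg _).trans (hD x x)
      have := mul_le_mul_of_nonneg_left hzx (show 0 ≤ L * D + M by positivity)
      linarith
    have h3 := mul_le_mul_of_nonneg_left h2 (show 0 ≤ 2 * h by positivity)
    push_cast
    nlinarith [mul_nonneg (mul_nonneg (sq_nonneg h) (Nat.cast_nonneg (α := ℝ) j)) (sq_nonneg M),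
      mul_nonneg (sq_nonneg h) (mul_nonneg (show 0 ≤ L * D + M from
        add_nonneg (mul_nonneg hL0 ((norm_nonneg _).trans (hD x x))) hM0) hM0)]

/-- A Lipschitz curve that satisfies the evolution variational inequality of the projected
dynamics up to an error of second order. -/
lemma exists_curve (hc : IsClosed X) (hv : Convex ℝ X) [CompactSpace X] {M L D : ℝ}
    (hM0 : 0 ≤ M) (hL0 : 0 ≤ L) (hM : ∀ x, ‖Q x‖ ≤ M)
    (hL : ∀ x y : X, ‖Q x - Q y‖ ≤ L * ‖(x : Euc d) - y‖) (hD : ∀ x y : X, ‖(x : Euc d) - y‖ ≤ D)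
    (hQ : Continuous Q) (x : X) :
    ∃ u : ℝ≥0 → X, u 0 = x ∧ (∀ s t, s ≤ t → ‖(u t : Euc d) - u s‖ ≤ (t - s) * M) ∧
      ∀ s t, s ≤ t → ∀ y : X, ‖(u t : Euc d) - y‖ ^ 2 ≤ ‖(u s : Euc d) - y‖ ^ 2 +
        2 * (t - s) * inner ℝ (Q (u s)) ((u s : Euc d) - y) +
        ((L * D + M) * M + M ^ 2) * (t - s) ^ 2 := by
  set v : ℕ → ℝ≥0 → X := fun n t => (eulerStep hc hv Q ((n : ℝ) + 1)⁻¹)^[⌊t * (n + 1)⌋₊] x with hvdef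
  -- Along an ultrafilter, compactness gives limits at all times simultaneously, without extracting
  -- subsequences.
  set F : Ultrafilter ℕ := hyperfilter ℕ with hF
  have hFle : (F : Filter ℕ) ≤ atTop := Nat.hyperfilter_le_atTop
  have hlim : ∀ t, ∃ y : X, Tendsto (fun n => v n t) F (𝓝 y) := fun t => by
    obtain ⟨y, -, hy⟩ := isCompact_univ.ultrafilter_le_nhds (F.map fun n => v n t)
      (by simp)
    exact ⟨y, hy⟩
  choose u hu using hlim
  have hτ : ∀ t : ℝ≥0, Tendsto (fun n : ℕ => ((⌊t * (n + 1)⌋₊ : ℝ)) / ((n : ℝ) + 1)) F (𝓝 t) := by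
    intro t
    have h1 := (tendsto_nat_floor_mul_div_atTop (R := ℝ) t.coe_nonneg).comp
      (tendsto_natCast_atTop_atTop.atTop_add (tendsto_const_nhds (x := (1 : ℝ))))
    refine (h1.mono_left hFle).congr fun n => ?_
    have : ⌊t * ((n : ℝ≥0) + 1)⌋₊ = ⌊(t : ℝ) * ((n : ℝ) + 1)⌋₊ := by
      refine le_antisymm (Nat.le_floor ?_) (Nat.le_floor ?_)
      · exact_mod_cast Nat.floor_le (zero_le (a := t * ((n : ℝ≥0) + 1)))
      · exact_mod_cast Nat.floor_le (show (0 : ℝ) ≤ t * ((n : ℝ) + 1) by positivity)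
    simp [this]
  have hval : ∀ t, Tendsto (fun n => (v n t : Euc d)) F (𝓝 (u t)) := fun t =>
    (continuous_subtype_val.tendsto _).comp (hu t)
  -- The scheme is autonomous: its state at `t` is obtained by running it afresh from its state at
  -- `s`, so the discrete estimates apply between any two times.
  have hsplit : ∀ s t, s ≤ t → ∀ n : ℕ, ∃ j : ℕ,
      v n t = (eulerStep hc hv Q ((n : ℝ) + 1)⁻¹)^[j] (v n s) ∧ ((n : ℝ) + 1)⁻¹ * j =
        (⌊t * (n + 1)⌋₊ : ℝ) / ((n : ℝ) + 1) - (⌊s * (n + 1)⌋₊ : ℝ) / ((n : ℝ) + 1) := by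
    intro s t hst n
    have hle : ⌊s * ((n : ℝ≥0) + 1)⌋₊ ≤ ⌊t * ((n : ℝ≥0) + 1)⌋₊ :=
      Nat.floor_le_floor (mul_le_mul_of_nonneg_right hst zero_le)
    refine ⟨⌊t * ((n : ℝ≥0) + 1)⌋₊ - ⌊s * ((n : ℝ≥0) + 1)⌋₊, ?_, ?_⟩
    · rw [hvdef]
      simp only
      rw [← Function.iterate_add_apply, Nat.sub_add_cancel hle]
    · rw [Nat.cast_sub hle]; ring
  have hd : ∀ s t : ℝ≥0, Tendsto (fun n : ℕ => (⌊t * (n + 1)⌋₊ : ℝ) / ((n : ℝ) + 1) -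
      (⌊s * (n + 1)⌋₊ : ℝ) / ((n : ℝ) + 1)) F (𝓝 (t - s)) := fun s t => (hτ t).sub (hτ s)
  refine ⟨u, ?_, fun s t hst => ?_, fun s t hst y => ?_⟩
  · refine tendsto_nhds_unique (hu 0) ?_
    simp [hvdef]
  · refine le_of_tendsto_of_tendsto' ((hval t).sub (hval s)).norm ((hd s t).mul_const M)
      fun n => ?_
    obtain ⟨j, hj, hj'⟩ := hsplit s t hst n
    rw [hj, ← hj']
    exact norm_iterate_eulerStep_sub_self_le hc hv (by positivity) hM j _
  · have hq : Tendsto (fun n => (inner ℝ (Q (v n s)) ((v n s : Euc d) - y) : ℝ)) F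
        (𝓝 (inner ℝ (Q (u s)) ((u s : Euc d) - y))) :=
      (((hQ.tendsto _).comp (hu s)).inner ((hval s).sub_const (y : Euc d)))
    refine le_of_tendsto_of_tendsto' (((hval t).sub_const (y : Euc d)).norm.pow 2)
      (((((hval s).sub_const (y : Euc d)).norm.pow 2).add (((hd s t).const_mul 2).mul hq)).add
        (((hd s t).pow 2).const_mul _)) fun n => ?_
    obtain ⟨j, hj, hj'⟩ := hsplit s t hst n
    rw [hj, ← hj']
    exact norm_iterate_eulerStep_sub_sq_le hc hv (by positivity) hM0 hL0 hM hL hD j _ y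

lemma norm_toNNReal_curve_sub_le {u : ℝ≥0 → X} {M : ℝ} (hM0 : 0 ≤ M)
    (hlip : ∀ s t, s ≤ t → ‖(u t : Euc d) - u s‖ ≤ (t - s) * M) :
    LipschitzWith M.toNNReal (fun t : ℝ => (u t.toNNReal : Euc d)) := by
  refine LipschitzWith.of_dist_le_mul fun s t => ?_
  rw [Real.coe_toNNReal _ hM0]
  wlog hst : t ≤ s generalizing s t
  · rw [dist_comm, dist_comm s t]; exact this t s (le_of_not_ge hst)
  rw [dist_eq_norm, mul_comm]
  refine (hlip _ _ (Real.toNNReal_mono hst)).trans (mul_le_mul_of_nonneg_right ?_ hM0)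
  rw [← NNReal.coe_sub (Real.toNNReal_mono hst)]
  have := Real.lipschitzWith_toNNReal.dist_le_mul s t
  rw [NNReal.dist_eq, ← NNReal.coe_sub (Real.toNNReal_mono hst)] at this
  simpa using (le_abs_self _).trans this

/-- A Lipschitz curve has a velocity `v` at almost every time. Right and left difference quotients
put `v` and `-v` in the tangent cone. Dividing the variational inequality by `s - t` and letting `s
↓ t` removes the quadratic error and shows that `Q - v` is normal; `metricProj_tangentCone_eq` then
identifies `v`. -/
lemma isTrajectory_of_curve (hv : Convex ℝ X) {u : ℝ≥0 → X} {M C : ℝ} (hM0 : 0 ≤ M)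
    (hlip : ∀ s t, s ≤ t → ‖(u t : Euc d) - u s‖ ≤ (t - s) * M)
    (hevi : ∀ s t, s ≤ t → ∀ y : X, ‖(u t : Euc d) - y‖ ^ 2 ≤ ‖(u s : Euc d) - y‖ ^ 2 +
        2 * (t - s) * inner ℝ (Q (u s)) ((u s : Euc d) - y) + C * (t - s) ^ 2) :
    IsTrajectory X Q u := by
  have hL := norm_toNNReal_curve_sub_le hM0 hlip
  refine ⟨fun T => hL.lipschitzOnWith.absolutelyContinuousOnInterval, ?_⟩
  rw [ae_restrict_iff' measurableSet_Ioi]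
  filter_upwards [hL.ae_differentiableAt_real] with t hdiff ht
  have ht0 : (0 : ℝ) < t := ht
  obtain ⟨v, hvd⟩ : ∃ v, HasDerivAt (fun t : ℝ => (u t.toNNReal : Euc d)) v t :=
    ⟨_, hdiff.hasDerivAt⟩
  convert! hvd
  have hr : Tendsto (slope (fun t : ℝ => (u t.toNNReal : Euc d)) t) (𝓝[>] t) (𝓝 v) :=
    (hasDerivAt_iff_tendsto_slope.1 hvd).mono_left (nhdsWithin_mono _ fun s hs => (ne_of_gt hs))
  have hl : Tendsto (slope (fun t : ℝ => (u t.toNNReal : Euc d)) t) (𝓝[<] t) (𝓝 v) :=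
    (hasDerivAt_iff_tendsto_slope.1 hvd).mono_left (nhdsWithin_mono _ fun s hs => (ne_of_lt hs))
  refine metricProj_tangentCone_eq hv ?_ ?_ ?_
  · refine (isClosed_tangentCone _).mem_of_tendsto hr ?_
    filter_upwards [self_mem_nhdsWithin] with s hs
    exact smul_sub_mem_tangentCone (u s.toNNReal).2 (inv_nonneg.2 (sub_nonneg.2 (le_of_lt hs)))
  · refine (isClosed_tangentCone _).mem_of_tendsto hl.neg ?_
    filter_upwards [self_mem_nhdsWithin] with s hs
    have : (0 : ℝ) ≤ -(s - t)⁻¹ := by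
      rw [← inv_neg, neg_sub]; exact inv_nonneg.2 (sub_nonneg.2 (le_of_lt hs))
    rw [slope_def_module, ← neg_smul]
    exact smul_sub_mem_tangentCone (u s.toNNReal).2 this
  · intro z hz
    set q : ℝ := inner ℝ (Q (u t.toNNReal)) ((u t.toNNReal : Euc d) - z) with hq
    have hd := (hvd.sub_const z).norm_sq
    have hr' := (hasDerivAt_iff_tendsto_slope.1 hd).mono_left
      (nhdsWithin_mono t (s := Ioi t) fun s hs => (ne_of_gt hs))
    have hb : Tendsto (fun s : ℝ => 2 * q + C * (s - t)) (𝓝[>] t) (𝓝 (2 * q + C * (t - t))) :=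
      Tendsto.mono_left (Continuous.tendsto (by fun_prop) t) nhdsWithin_le_nhds
    have key := le_of_tendsto_of_tendsto hr' hb (by
      filter_upwards [self_mem_nhdsWithin] with s hs
      have hs' : t < s := hs
      have h1 := hevi _ _ (Real.toNNReal_mono hs'.le) ⟨z, hz⟩
      rw [Real.coe_toNNReal _ ht0.le, Real.coe_toNNReal _ (ht0.trans hs').le] at h1
      rw [slope_def_field, div_le_iff₀ (sub_pos.2 hs')]
      simp only at h1
      rw [← hq] at h1
      nlinarith)
    simp only [sub_self, mul_zero, add_zero] at key
    have e : (inner ℝ (Q (u t.toNNReal) - v) (z - (u t.toNNReal : Euc d)) : ℝ) =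
        inner ℝ ((u t.toNNReal : Euc d) - z) v - q := by
      rw [hq, real_inner_comm v]
      simp only [inner_sub_left, inner_sub_right]; ring
    rw [e]
    linarith

end Euler

/-! ## Well-posedness -/

section WellPosed

variable {d : ℕ} {X : Set (Euc d)} {Q : X → Euc d}

lemma extendField_apply (Q : X → Euc d) (x : X) : extendField X Q x = Q x :=
  Subtype.val_injective.extend_apply _ _ _

lemma extendField_of_mem (Q : X → Euc d) {x : Euc d} (hx : x ∈ X) :
    extendField X Q x = Q ⟨x, hx⟩ := extendField_apply Q ⟨x, hx⟩

lemma IsC2ConvexBody.isCompact (hX : IsC2ConvexBody X) : IsCompact X :=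
  Metric.isCompact_of_isClosed_isBounded hX.isClosed hX.isBounded

lemma IsC1Field.exists_lipschitz (hX : IsC2ConvexBody X) (hQ : IsC1Field X Q) :
    ∃ L : ℝ, 0 ≤ L ∧ ∀ x y : X, ‖Q x - Q y‖ ≤ L * ‖(x : Euc d) - y‖ := by
  obtain ⟨K, hK⟩ := ContDiffOn.exists_lipschitzOnWith hQ (by decide) hX.convex hX.isCompact
  refine ⟨K, K.coe_nonneg, fun x y => ?_⟩
  have := hK.dist_le_mul x x.2 y y.2
  rwa [extendField_apply, extendField_apply, dist_eq_norm, dist_eq_norm] at this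

lemma IsC1Field.continuous (hQ : IsC1Field X Q) : Continuous Q := by
  have := continuousOn_iff_continuous_domRestrict.1 (ContDiffOn.continuousOn hQ)
  exact this.congr fun x => extendField_apply Q x

theorem IsC1Field.wellBehaved (hX : IsC2ConvexBody X) (hQ : IsC1Field X Q) :
    WellBehaved X Q := by
  have : CompactSpace X := isCompact_iff_compactSpace.1 hX.isCompact
  obtain ⟨L, hL0, hL⟩ := hQ.exists_lipschitz hX
  obtain ⟨M', hM'⟩ := isCompact_univ.exists_bound_of_continuousOn hQ.continuous.continuousOn
  have hM : ∀ x, ‖Q x‖ ≤ max M' 0 := fun x => (hM' x (mem_univ x)).trans (le_max_left _ _)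
  obtain ⟨D, -, hD⟩ := exists_norm_sub_le hX.isBounded
  choose u hu0 hulip huevi using
    exists_curve hX.isClosed hX.convex (le_max_right M' 0) hL0 hM hL hD hQ.continuous
  have htraj : ∀ x, IsTrajectory X Q (u x) := fun x =>
    isTrajectory_of_curve hX.convex (le_max_right M' 0) (hulip x) (huevi x)
  refine ⟨fun z => u z.1 z.2, ⟨?_, hu0, fun x => (htraj x).absCont, fun x => (htraj x).deriv⟩,
    fun G hG => ?_⟩
  · rw [continuous_iff_continuousAt]
    rintro ⟨x, t⟩
    rw [ContinuousAt, tendsto_subtype_rng, tendsto_iff_norm_sub_tendsto_zero]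
    have hlip : ∀ s t : ℝ≥0, ∀ x, ‖(u x t : Euc d) - u x s‖ ≤ |(t : ℝ) - s| * max M' 0 := by
      intro s t x
      rcases le_total s t with h | h
      · rw [abs_of_nonneg (sub_nonneg.2 (by exact_mod_cast h))]; exact hulip x s t h
      · rw [norm_sub_rev, abs_sub_comm, abs_of_nonneg (sub_nonneg.2 (by exact_mod_cast h))]
        exact hulip x t s h
    -- Joint continuity: compare through `u y t`, using the Lipschitz bound in time and the
    -- stability estimate at the fixed time `t`.
    have hbound : ∀ z : X × ℝ≥0, ‖(u z.1 z.2 : Euc d) - u x t‖ ≤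
        Real.exp (L * t) * ‖(z.1 : Euc d) - x‖ + |(z.2 : ℝ) - t| * max M' 0 := by
      rintro ⟨y, s⟩
      have h1 := (htraj y).norm_sub_le hX.convex hX.isBounded hL (htraj x) t
      rw [hu0, hu0] at h1
      have h2 := hlip t s y
      have h3 := norm_sub_le_norm_sub_add_norm_sub (u y s : Euc d) (u y t) (u x t)
      simp only
      linarith
    refine squeeze_zero (fun _ => norm_nonneg _) hbound ?_
    have hcont : Continuous fun z : X × ℝ≥0 =>
        Real.exp (L * t) * ‖(z.1 : Euc d) - x‖ + |(z.2 : ℝ) - t| * max M' 0 := by fun_prop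
    simpa using hcont.tendsto (x, t)
  · funext ⟨x, t⟩
    have h := (hG.isTrajectory x).norm_sub_le hX.convex hX.isBounded hL (htraj x) t
    simp only [hG.init, hu0, sub_self, norm_zero, mul_zero] at h
    exact Subtype.ext (sub_eq_zero.1 (norm_le_zero_iff.1 h))

/-- If there are finitely many equilibria, then there are finitely many reachable terminal
states. -/
theorem IsC1Field.hasFinitelyManyRTS (hX : IsC2ConvexBody X) (hQ : IsC1Field X Q)
    (hfin : {x : X | Q x ∈ normalCone X x}.Finite) : HasFinitelyManyRTS X Q := by
  refine ⟨hQ.wellBehaved hX, ((hfin.image some).union (finite_singleton none)).subset ?_⟩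
  rintro _ ⟨x, rfl⟩
  unfold dynamicSolver
  split_ifs with hl
  · refine Or.inl ⟨hl.choose, ?_, rfl⟩
    exact ((hQ.wellBehaved hX).choose_spec.1.isTrajectory x).mem_normalCone_of_tendsto hX.convex
      hX.isBounded hQ.continuous hl.choose_spec
  · exact Or.inr rfl

end WellPosed

/-! ## Parametric transversality -/

section Transversality

variable {V W F : Type*} [NormedAddCommGroup V] [NormedSpace ℝ V] [FiniteDimensional ℝ V]
  [NormedAddCommGroup W] [NormedSpace ℝ W] [FiniteDimensional ℝ W]
  [NormedAddCommGroup F] [NormedSpace ℝ F]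

/-- By rank–nullity `ker A` has the dimension of `V`. Take for `Λ` a projection onto `ker A`
followed by an identification with `V`; it serves as a chart of the zero set. -/
lemma exists_injective_prod (hdim : Module.finrank ℝ W = Module.finrank ℝ F)
    (A : V × W →L[ℝ] F) (hA : Function.Surjective A) :
    ∃ Λ : V × W →L[ℝ] V, Function.Injective (A.prod Λ) := by
  set K := LinearMap.ker (A : V × W →ₗ[ℝ] F)
  have hK : Module.finrank ℝ K = Module.finrank ℝ V := by
    have h := LinearMap.finrank_range_add_finrank_ker (A : V × W →ₗ[ℝ] F)
    rw [LinearMap.range_eq_top.2 hA, finrank_top, Module.finrank_prod, hdim] at h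
    change Module.finrank ℝ F + Module.finrank ℝ K = _ at h
    lia
  obtain ⟨r, hr⟩ := K.subtype.exists_leftInverse_of_injective K.ker_subtype
  refine ⟨LinearMap.toContinuousLinearMap
    ((LinearEquiv.ofFinrankEq K V hK : K →ₗ[ℝ] V).comp r), ?_⟩
  rw [injective_iff_map_eq_zero]
  intro z hz
  have h1 : A z = 0 := congrArg Prod.fst hz
  have h2 : LinearEquiv.ofFinrankEq K V hK (r z) = 0 := congrArg Prod.snd hz
  have h3 : r z = ⟨z, h1⟩ := LinearMap.congr_fun hr ⟨z, h1⟩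
  rw [LinearEquiv.map_eq_zero_iff, h3] at h2
  exact congrArg Subtype.val h2

variable [FiniteDimensional ℝ F]

lemma exists_leftInverse_prod (hdim : Module.finrank ℝ W = Module.finrank ℝ F)
    {T : V × W →L[ℝ] F × V} (hT : Function.Injective T) :
    ∃ S : F × V →L[ℝ] V × W, Function.LeftInverse S T ∧ Function.RightInverse S T := by
  have hd : Module.finrank ℝ (V × W) = Module.finrank ℝ (F × V) := by
    rw [Module.finrank_prod, Module.finrank_prod, hdim, add_comm]
  let e := LinearMap.linearEquivOfInjective (T : V × W →ₗ[ℝ] F × V) hT hd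
  exact ⟨LinearMap.toContinuousLinearMap (e.symm : F × V →ₗ[ℝ] V × W),
    e.symm_apply_apply, e.apply_symm_apply⟩

variable [MeasurableSpace V] [BorelSpace V] (μ : Measure V) [μ.IsAddHaarMeasure]

/-- Near `z₀`, `Λ` is injective on the zeros in `M`, with Lipschitz inverse `g`. The map `s ↦ (g
s).1` goes between spaces of equal dimension, and its derivative kills `Λ (0, w)` for a degenerate
direction `w`. A map with vanishing Jacobian determinant has null image. Convexity of `C` gives the
mean value inequality also at points of `C` that are not interior. -/
lemma exists_nhdsWithin_measure_fst_image_eq_zero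
    (hdim : Module.finrank ℝ W = Module.finrank ℝ F) {C M : Set (V × W)} (hC : Convex ℝ C)
    {f : V × W → F} {A : V × W → V × W →L[ℝ] F}
    (hf : ∀ z ∈ C, HasFDerivWithinAt f (A z) C z) (hA : ContinuousOn A C) (hMC : M ⊆ C)
    (hM : ∀ z ∈ M, f z = 0 ∧ Function.Surjective (A z) ∧ ∃ w : W, w ≠ 0 ∧ A z (0, w) = 0)
    {z₀ : V × W} (hz₀ : z₀ ∈ M) : ∃ t ∈ 𝓝[M] z₀, μ (Prod.fst '' t) = 0 := by
  obtain ⟨Λ, hΛ⟩ := exists_injective_prod hdim (A z₀) (hM z₀ hz₀).2.1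
  obtain ⟨S₀, hS₀, -⟩ := exists_leftInverse_prod hdim hΛ
  set κ : ℝ := ‖S₀‖ + 1 with hκ
  have hκ0 : 0 < κ := by positivity
  have hbd : ∀ z, ‖z‖ ≤ κ * max ‖A z₀ z‖ ‖Λ z‖ := fun z => by
    calc ‖z‖ = ‖S₀ ((A z₀).prod Λ z)‖ := by rw [hS₀ z]
      _ ≤ ‖S₀‖ * ‖(A z₀).prod Λ z‖ := S₀.le_opNorm _
      _ ≤ κ * max ‖A z₀ z‖ ‖Λ z‖ :=
        mul_le_mul_of_nonneg_right (by linarith) (norm_nonneg _)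
  -- With the factor `(2κ)⁻¹`, the `A z₀` term accounts for at most half of `‖z‖`, so it can attain
  -- the maximum only in trivial cases.
  have key : ∀ z, ‖A z₀ z‖ ≤ (2 * κ)⁻¹ * ‖z‖ → ‖z‖ ≤ κ * ‖Λ z‖ := by
    intro z hz
    have h1 := hbd z
    rcases le_total ‖A z₀ z‖ ‖Λ z‖ with h | h
    · rwa [max_eq_right h] at h1
    · rw [max_eq_left h] at h1
      have h2 := mul_le_mul_of_nonneg_left hz hκ0.le
      rw [mul_inv, ← mul_assoc, mul_comm (2 : ℝ)⁻¹, ← mul_assoc, mul_inv_cancel₀ hκ0.ne',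
        one_mul] at h2
      have h3 : ‖z‖ ≤ 0 := by linarith
      exact h3.trans (by positivity)
  have hnear : ∀ᶠ z in 𝓝[C] z₀, ‖A z - A z₀‖ ≤ (2 * κ)⁻¹ := by
    have h1 := (hA z₀ (hMC hz₀)).sub_const (A z₀)
    have h2 := h1.norm
    rw [sub_self, norm_zero] at h2
    exact (h2.eventually (gt_mem_nhds (by positivity : 0 < (2 * κ)⁻¹))).mono fun _ h => h.le
  obtain ⟨r, hr, hball⟩ := Metric.mem_nhdsWithin_iff.1 hnear
  set t := M ∩ Metric.ball z₀ r with ht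
  refine ⟨t, inter_mem_nhdsWithin _ (Metric.ball_mem_nhds _ hr), ?_⟩
  have htC : t ⊆ C := inter_subset_left.trans hMC
  have hAz : ∀ z ∈ t, ‖A z - A z₀‖ ≤ (2 * κ)⁻¹ := fun z hz => hball ⟨hz.2, htC hz⟩
  have hlip : ∀ z ∈ t, ∀ z' ∈ t, ‖z - z'‖ ≤ κ * ‖Λ z - Λ z'‖ := by
    intro z hz z' hz'
    rw [← map_sub]
    refine key _ ?_
    -- `f` vanishes at both points, so the mean value inequality bounds `A z₀ (z - z')` itself, as
    -- `key` requires.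
    have h := (hC.inter (convex_ball z₀ r)).norm_image_sub_le_of_norm_hasFDerivWithin_le'
      (fun x hx => (hf x hx.1).mono inter_subset_left) (φ := A z₀)
      (fun x hx => hball ⟨hx.2, hx.1⟩) ⟨htC hz', hz'.2⟩ ⟨htC hz, hz.2⟩
    rwa [(hM z hz.1).1, (hM z' hz'.1).1, sub_self, zero_sub, norm_neg] at h
  have hinj : InjOn Λ t := fun z hz z' hz' h => by
    have := hlip z hz z' hz'
    rw [h, sub_self, norm_zero, mul_zero] at this
    exact sub_eq_zero.1 (norm_le_zero_iff.1 this)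
  have hT : ∀ z ∈ t, Function.Injective ((A z).prod Λ) := by
    intro z hz
    rw [injective_iff_map_eq_zero]
    intro x hx
    have h1 : A z x = 0 := congrArg Prod.fst hx
    have h2 : Λ x = 0 := congrArg Prod.snd hx
    have h3 : ‖A z₀ x‖ ≤ (2 * κ)⁻¹ * ‖x‖ := by
      have := (A z - A z₀).le_opNorm x
      rw [sub_apply, h1, zero_sub, norm_neg] at this
      exact this.trans (mul_le_mul_of_nonneg_right (hAz z hz) (norm_nonneg _))
    have := key x h3
    rw [h2, norm_zero, mul_zero] at this
    exact norm_le_zero_iff.1 this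
  set g := Function.invFunOn Λ t with hg
  have hgL : ∀ z ∈ t, g (Λ z) = z := fun z hz => hinj.leftInvOn_invFunOn hz
  have himg : (fun s => (g s).1) '' (Λ '' t) = Prod.fst '' t := by
    rw [image_image]
    exact image_congr fun z hz => by rw [hgL z hz]
  have hder : ∀ s ∈ Λ '' t, ∃ B : V →L[ℝ] V,
      HasFDerivWithinAt (fun s => (g s).1) B (Λ '' t) s ∧ B.det = 0 := by
    rintro _ ⟨z, hz, rfl⟩
    obtain ⟨S, hS, -⟩ := exists_leftInverse_prod hdim (hT z hz)
    have hΦ : HasFDerivWithinAt (fun y => (f y, Λ y)) ((A z).prod Λ) t (g (Λ z)) := by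
      rw [hgL z hz]
      exact ((hf z (htC hz)).mono htC).prodMk Λ.hasFDerivWithinAt
    have hgt : Tendsto g (𝓝[Λ '' t] (Λ z)) (𝓝[t] (g (Λ z))) := by
      refine tendsto_nhdsWithin_of_tendsto_nhds_of_eventually_within _ ?_ ?_
      · have hL : LipschitzOnWith κ.toNNReal g (Λ '' t) := by
          refine LipschitzOnWith.of_dist_le_mul ?_
          rintro _ ⟨x, hx, rfl⟩ _ ⟨y, hy, rfl⟩
          rw [hgL x hx, hgL y hy, dist_eq_norm, dist_eq_norm, Real.coe_toNNReal _ hκ0.le]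
          exact hlip x hx y hy
        exact hL.continuousOn (Λ z) (mem_image_of_mem _ hz)
      · filter_upwards [self_mem_nhdsWithin]
        rintro _ ⟨x, hx, rfl⟩
        rwa [hgL x hx]
    -- On `Λ '' t` one has `(f, Λ) ∘ g = (0, ·)`, so `g` is differentiable there with derivative `S
    -- (0, ·)`.
    have hg' := HasFDerivWithinAt.of_comp_of_leftInverse (f'symm := S) hgt hΦ
      (h := fun s => ((0 : F), s)) (h' := ContinuousLinearMap.inr ℝ F V)
      (ContinuousLinearMap.inr ℝ F V).hasFDerivWithinAt (by
        filter_upwards [self_mem_nhdsWithin]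
        rintro _ ⟨x, hx, rfl⟩
        simp only [Function.comp_apply]
        rw [hgL x hx, (hM x hx.1).1]) hS (mem_image_of_mem _ hz)
    refine ⟨_, hg'.fst, ?_⟩
    obtain ⟨w, hw0, hw⟩ := (hM z hz.1).2.2
    have hTw : (A z).prod Λ (0, w) = (0, Λ (0, w)) := by simp [hw]
    refine LinearMap.det_eq_zero_iff_ker_ne_bot.2 ((Submodule.ne_bot_iff _).2 ⟨Λ (0, w), ?_, ?_⟩)
    · rw [LinearMap.mem_ker]
      change (S (0, Λ (0, w))).1 = 0
      rw [← hTw, hS]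
    · intro h0
      have : (0, w) = (0 : V × W) := hT z hz (by rw [hTw, h0, map_zero]; rfl)
      exact hw0 (congrArg Prod.snd this)
  choose! B hB hdet using hder
  rw [← himg]
  exact addHaar_image_eq_zero_of_det_fderivWithin_eq_zero μ hB hdet

/-- The parameters for which a `C¹` map, submersive along its zeros, has a zero that is degenerate
in the direction of the variables form a null set. -/
theorem measure_fst_image_degenerate_zeros
    (hdim : Module.finrank ℝ W = Module.finrank ℝ F) {C M : Set (V × W)} (hC : Convex ℝ C)
    {f : V × W → F} {A : V × W → V × W →L[ℝ] F}
    (hf : ∀ z ∈ C, HasFDerivWithinAt f (A z) C z) (hA : ContinuousOn A C) (hMC : M ⊆ C)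
    (hM : ∀ z ∈ M, f z = 0 ∧ Function.Surjective (A z) ∧ ∃ w : W, w ≠ 0 ∧ A z (0, w) = 0) :
    μ (Prod.fst '' M) = 0 := by
  have h := fun z (hz : z ∈ M) =>
    exists_nhdsWithin_measure_fst_image_eq_zero μ hdim hC hf hA hMC hM hz
  choose! t ht hμ using h
  -- Lindelöf: countably many of the local null sets suffice.
  obtain ⟨s, hsM, hs, hcov⟩ := TopologicalSpace.countable_cover_nhdsWithin ht
  refine measure_mono_null (image_mono hcov) ?_
  rw [image_iUnion₂]
  exact (measure_biUnion_null_iff hs).2 fun z hz => hμ z (hsM hz)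

end Transversality

/-- A zero with injective derivative is isolated. -/
lemma eventually_ne_zero_of_injective {W F : Type*} [NormedAddCommGroup W] [NormedSpace ℝ W]
    [FiniteDimensional ℝ W] [NormedAddCommGroup F] [NormedSpace ℝ F] {f : W → F} {A : W →L[ℝ] F}
    {s : Set W} {x : W} (hf : HasFDerivWithinAt f A s x) (hA : Function.Injective A) :
    ∀ᶠ y in 𝓝[s] x, y ≠ x → f y ≠ f x := by
  obtain ⟨K, hK, hK'⟩ := (A : W →ₗ[ℝ] F).exists_antilipschitzWith (LinearMap.ker_eq_bot.2 hA)
  -- Half of the lower bound `‖A y - A x‖ ≥ K⁻¹ ‖y - x‖`, so the linear part dominates the error.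
  have h := hf.isLittleO.def (c := (2 * (K : ℝ))⁻¹) (by positivity)
  filter_upwards [h] with y hy hne heq
  rw [heq, sub_self, zero_sub, norm_neg] at hy
  have h1 := hK'.le_mul_dist y x
  rw [dist_eq_norm, dist_eq_norm] at h1
  change ‖y - x‖ ≤ K * ‖A y - A x‖ at h1
  rw [← map_sub] at h1
  have h2 := mul_le_mul_of_nonneg_left hy K.coe_nonneg
  have hK0 : (K : ℝ) ≠ 0 := by exact_mod_cast hK.ne'
  have h3 : (K : ℝ) * ((2 * (K : ℝ))⁻¹ * ‖y - x‖) = ‖y - x‖ / 2 := by field_simp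
  have : 0 < ‖y - x‖ := norm_pos_iff.2 (sub_ne_zero.2 hne)
  linarith

/-! ## Normal cones of convex bodies with `C²` boundary -/

section Boundary

variable {d : ℕ} {X : Set (Euc d)}

lemma exists_riesz_map (d : ℕ) : ∃ T : (Euc d →L[ℝ] ℝ) →L[ℝ] Euc d,
    ∀ (f : Euc d →L[ℝ] ℝ) (w : Euc d), inner ℝ (T f) w = f w := by
  let T : (Euc d →L[ℝ] ℝ) →ₗ[ℝ] Euc d :=
    { toFun := (InnerProductSpace.toDual ℝ (Euc d)).symm
      map_add' := fun f g => map_add _ f g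
      map_smul' := fun c f => by simp }
  exact ⟨LinearMap.toContinuousLinearMap T, fun f w => InnerProductSpace.toDual_symm_apply⟩

lemma eventually_lt_of_hasDerivAt_neg {φ : ℝ → ℝ} {φ' : ℝ} (h : HasDerivAt φ φ' 0)
    (hneg : φ' < 0) : ∀ᶠ t in 𝓝[>] (0 : ℝ), φ t < φ 0 := by
  have h1 : Tendsto (slope φ 0) (𝓝[>] 0) (𝓝 φ') :=
    (hasDerivAt_iff_tendsto_slope.1 h).mono_left
      (nhdsWithin_mono 0 (s := Ioi 0) fun s hs => (ne_of_gt hs))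
  filter_upwards [h1.eventually (gt_mem_nhds hneg), self_mem_nhdsWithin] with t ht ht0
  rw [slope_def_field, sub_zero, div_lt_iff₀ ht0, zero_mul] at ht
  linarith

lemma hasDerivAt_line {ρ : Euc d → ℝ} {x w : Euc d} (h : DifferentiableAt ℝ ρ x) :
    HasDerivAt (fun t : ℝ => ρ (x + t • w)) (fderiv ℝ ρ x w) 0 := by
  have h1 : HasDerivAt (fun t : ℝ => x + t • w) w 0 := by
    simpa using ((hasDerivAt_id (0 : ℝ)).smul_const w).const_add x
  have h2 : HasFDerivAt ρ (fderiv ℝ ρ x) (x + (0 : ℝ) • w) := by simpa using h.hasFDerivAt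
  exact h2.comp_hasDerivAt 0 h1

lemma eventually_line_mem {U : Set (Euc d)} {x : Euc d} (hU : U ∈ 𝓝 x) (w : Euc d) :
    ∀ᶠ t in 𝓝[>] (0 : ℝ), x + t • w ∈ U := by
  have hc : Continuous fun t : ℝ => x + t • w := by fun_prop
  have : Tendsto (fun t : ℝ => x + t • w) (𝓝 0) (𝓝 x) := by simpa using hc.tendsto 0
  exact (this.mono_left nhdsWithin_le_nhds).eventually hU

/-- The polar of a half-space is a ray. For the component `w` of `v` orthogonal to `g`, test with `w
- ε • g` and let `ε → 0`: this gives `‖w‖² = ⟨v, w⟩ ≤ 0`. -/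
lemma eq_smul_of_inner_nonpos {g v : Euc d} (hg : g ≠ 0)
    (h : ∀ w, inner ℝ g w < (0 : ℝ) → inner ℝ v w ≤ (0 : ℝ)) : ∃ c : ℝ, 0 ≤ c ∧ v = c • g := by
  have hgg : 0 < (inner ℝ g g : ℝ) := by
    rw [real_inner_self_eq_norm_sq]; exact pow_pos (norm_pos_iff.2 hg) 2
  set c : ℝ := inner ℝ g v / inner ℝ g g with hc
  refine ⟨c, div_nonneg ?_ hgg.le, ?_⟩
  · have := h (-g) (by rw [inner_neg_right]; linarith)
    rw [inner_neg_right, real_inner_comm] at this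
    linarith
  · set w := v - c • g with hw
    have hgw : (inner ℝ g w : ℝ) = 0 := by
      rw [hw, inner_sub_right, inner_smul_right, hc, div_mul_cancel₀ _ hgg.ne', sub_self]
    have h1 : ∀ ε : ℝ, 0 < ε → (inner ℝ v w : ℝ) ≤ ε * inner ℝ v g := by
      intro ε hε
      have := h (w - ε • g) (by
        rw [inner_sub_right, inner_smul_right, hgw]
        have := mul_pos hε hgg
        linarith)
      rw [inner_sub_right, inner_smul_right] at this
      linarith
    have h2 : (inner ℝ v w : ℝ) ≤ 0 := by
      have hl : Tendsto (fun ε : ℝ => ε * inner ℝ v g) (𝓝[>] 0) (𝓝 (0 * inner ℝ v g)) :=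
        Tendsto.mono_left (Continuous.tendsto (by fun_prop) 0) nhdsWithin_le_nhds
      rw [zero_mul] at hl
      exact ge_of_tendsto hl (by filter_upwards [self_mem_nhdsWithin] with ε hε using h1 ε hε)
    have h3 : (inner ℝ w w : ℝ) ≤ 0 := by
      have e : (inner ℝ w w : ℝ) = inner ℝ v w - c * inner ℝ g w := by
        conv_lhs => rw [hw, inner_sub_left, inner_smul_left]
        simp [hw]
      rw [e, hgw]; linarith
    have h4 : w = 0 := real_inner_self_nonpos.1 h3
    exact sub_eq_zero.1 h4

/-- Near a boundary point there is a defining function of `X` with non-vanishing derivative, and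
the outward normal is the restriction of a `C¹` field that spans the normal cones. -/
lemma IsC2ConvexBody.exists_local (hX : IsC2ConvexBody X) {x₀ : Euc d} (hx₀ : x₀ ∈ frontier X) :
    ∃ (U : Set (Euc d)) (ρ : Euc d → ℝ) (ν : Euc d → Euc d), IsOpen U ∧ x₀ ∈ U ∧
      ContDiffOn ℝ 1 ρ U ∧ ContDiffOn ℝ 1 ν U ∧ (∀ x ∈ U, fderiv ℝ ρ x ≠ 0) ∧
      ∀ x ∈ U ∩ frontier X, ρ x = 0 ∧ outwardNormal X x = ν x ∧ ‖ν x‖ = 1 ∧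
        ∀ v ∈ normalCone X x, ∃ α : ℝ, 0 ≤ α ∧ v = α • ν x := by
  obtain ⟨U, ρ, hU, hxU, hρ, hρ0, hXU⟩ := hX.boundary x₀ hx₀
  obtain ⟨T, hT⟩ := exists_riesz_map d
  have hfd : ContDiffOn ℝ 1 (fderiv ℝ ρ) U := hρ.fderiv_of_isOpen hU (by norm_num)
  have hg : ContDiffOn ℝ 1 (fun x => T (fderiv ℝ ρ x)) U := T.contDiff.comp_contDiffOn hfd
  have hTne : ∀ f : Euc d →L[ℝ] ℝ, f ≠ 0 → T f ≠ 0 := fun f hf h => hf (by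
    ext w; rw [← hT, h, inner_zero_left]; rfl)
  refine ⟨U ∩ {x | fderiv ℝ ρ x ≠ 0}, ρ,
    fun x => (‖T (fderiv ℝ ρ x)‖)⁻¹ • T (fderiv ℝ ρ x),
    hfd.continuousOn.isOpen_inter_preimage hU isOpen_ne, ⟨hxU, hρ0⟩,
    (hρ.of_le (by norm_num)).mono inter_subset_left, ?_, fun x hx => hx.2, ?_⟩
  · have hg' := hg.mono (inter_subset_left (t := {x | fderiv ℝ ρ x ≠ 0}))
    exact ((hg'.norm ℝ fun x hx => hTne _ hx.2).inv fun x hx =>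
      norm_ne_zero_iff.2 (hTne _ hx.2)).smul hg'
  · rintro x ⟨⟨hxU, hx0⟩, hxf⟩
    set g := T (fderiv ℝ ρ x) with hgdef
    have hgne : g ≠ 0 := hTne _ hx0
    have hxX : x ∈ X := hX.isClosed.frontier_subset hxf
    have hUx : U ∈ 𝓝 x := hU.mem_nhds hxU
    have hdiff : DifferentiableAt ℝ ρ x := (hρ.contDiffAt hUx).differentiableAt (by norm_num)
    have hmem : ∀ y ∈ U, (y ∈ X ↔ ρ y ≤ 0) := fun y hy =>
      ⟨fun h => (hXU.subset ⟨h, hy⟩ : y ∈ {y | ρ y ≤ 0} ∩ U).1,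
        fun h => (hXU.symm.subset ⟨h, hy⟩ : y ∈ X ∩ U).1⟩
    have hρx : ρ x = 0 := by
      refine le_antisymm ((hmem x hxU).1 hxX) ?_
      by_contra! hlt
      have : X ∈ 𝓝 x := by
        filter_upwards [hUx, hdiff.continuousAt.eventually (gt_mem_nhds hlt)] with y hy hy'
        exact (hmem y hy).2 (le_of_lt hy')
      exact hxf.2 (mem_interior_iff_mem_nhds.2 this)
    -- If `ρ` had positive derivative towards some `y ∈ X`, it would become positive on the segment
    -- to `y`, which stays in `X`.
    have hgN : g ∈ normalCone X x := by
      intro y hy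
      by_contra! hpos
      have hd := hasDerivAt_line (w := y - x) hdiff
      rw [hT] at hpos
      have hev := eventually_lt_of_hasDerivAt_neg hd.neg (by linarith)
      obtain ⟨t, ht, htU, ht0, ht1⟩ := (hev.and ((eventually_line_mem hUx (y - x)).and
        (Ioo_mem_nhdsGT (zero_lt_one' ℝ)))).exists
      have htX : x + t • (y - x) ∈ X := hX.convex.add_smul_sub_mem hxX hy ⟨ht0.le, ht1.le⟩
      have := (hmem _ htU).1 htX
      simp only [Pi.neg_apply, zero_smul, add_zero, hρx] at ht
      linarith
    -- Directions in which `ρ` strictly decreases enter `X`, so a normal vector pairs nonpositively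
    -- with them.
    have hspan : ∀ v ∈ normalCone X x, ∃ c : ℝ, 0 ≤ c ∧ v = c • g := by
      intro v hv
      refine eq_smul_of_inner_nonpos hgne fun w hw => ?_
      rw [hT] at hw
      obtain ⟨t, ht, htU, ht0⟩ := ((eventually_lt_of_hasDerivAt_neg
        (hasDerivAt_line hdiff) hw).and
        ((eventually_line_mem hUx w).and self_mem_nhdsWithin)).exists
      simp only [zero_smul, add_zero, hρx] at ht
      have := hv _ ((hmem _ htU).2 ht.le)
      rw [add_sub_cancel_left, inner_smul_right] at this
      exact nonpos_of_mul_nonpos_right this ht0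
    have hgpos : 0 < ‖g‖ := norm_pos_iff.2 hgne
    have hν1 : ‖(‖g‖)⁻¹ • g‖ = 1 := by
      rw [norm_smul, norm_inv, norm_norm, inv_mul_cancel₀ hgpos.ne']
    refine ⟨hρx, ?_, hν1, fun v hv => ?_⟩
    · have hex : ∃ v, v ∈ normalCone X x ∧ ‖v‖ = 1 := by
        refine ⟨(‖g‖)⁻¹ • g, fun y hy => ?_, hν1⟩
        rw [real_inner_smul_left]
        exact mul_nonpos_of_nonneg_of_nonpos (by positivity) (hgN y hy)
      have hn : outwardNormal X x ∈ normalCone X x ∧ ‖outwardNormal X x‖ = 1 :=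
        Classical.epsilon_spec hex
      obtain ⟨c, hc0, hc⟩ := hspan _ hn.1
      have h1 := hn.2
      rw [hc, norm_smul, Real.norm_of_nonneg hc0] at h1
      rw [hc, eq_inv_of_mul_eq_one_left h1]
    · obtain ⟨c, hc0, rfl⟩ := hspan v hv
      refine ⟨c * ‖g‖, by positivity, ?_⟩
      rw [smul_smul, mul_assoc, mul_inv_cancel₀ hgpos.ne', mul_one]

lemma eq_zero_of_mem_normalCone_of_mem_interior {x v : Euc d} (hx : x ∈ interior X)
    (hv : v ∈ normalCone X x) : v = 0 := by
  obtain ⟨t, ht, ht0⟩ := ((eventually_line_mem (mem_interior_iff_mem_nhds.1 hx) v).and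
    self_mem_nhdsWithin).exists
  have := hv _ ht
  rw [add_sub_cancel_left, inner_smul_right] at this
  exact real_inner_self_nonpos.1 (nonpos_of_mul_nonpos_right this ht0)

end Boundary

/-! ## Finitely many equilibria -/

lemma finite_of_eventually_eq {W : Type*} [TopologicalSpace W] {K Z : Set W} (hK : IsCompact K)
    (hZ : Z ⊆ K) (h : ∀ x ∈ K, ∀ᶠ z in 𝓝 x, z ∈ Z → z = x) : Z.Finite := by
  by_contra hinf
  obtain ⟨x, hxK, hx⟩ := Set.Infinite.exists_accPt_of_subset_isCompact hinf hK hZ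
  obtain ⟨z, ⟨hzx, hzZ⟩, hz⟩ := ((accPt_iff_frequently.1 hx).and_eventually (h x hxK)).exists
  exact hzx (hz hzZ)

lemma eventually_eq_of_hasFDerivWithinAt {W F : Type*} [NormedAddCommGroup W] [NormedSpace ℝ W]
    [FiniteDimensional ℝ W] [NormedAddCommGroup F] [NormedSpace ℝ F] {f : W → F} {A : W →L[ℝ] F}
    {s Z : Set W} {x : W} (hf : HasFDerivWithinAt f A s x)
    (hA : f x = 0 → Function.Injective A) (hZ : ∀ᶠ z in 𝓝 x, z ∈ Z → z ∈ s ∧ f z = 0) :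
    ∀ᶠ z in 𝓝 x, z ∈ Z → z = x := by
  by_cases h0 : f x = 0
  · have h1 := eventually_ne_zero_of_injective hf (hA h0)
    rw [eventually_nhdsWithin_iff] at h1
    filter_upwards [h1, hZ] with z hz hz' hzZ
    by_contra hne
    exact hz (hz' hzZ).1 hne ((hz' hzZ).2.trans h0.symm)
  · have h1 := hf.continuousWithinAt.eventually (isOpen_ne.mem_nhds h0)
    rw [eventually_nhdsWithin_iff] at h1
    filter_upwards [h1, hZ] with z hz hz' hzZ
    exact absurd (hz' hzZ).2 (hz (hz' hzZ).1)

section Generic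

variable {V W F : Type*} [NormedAddCommGroup V] [NormedSpace ℝ V]
  [NormedAddCommGroup W] [NormedSpace ℝ W] [NormedAddCommGroup F] [NormedSpace ℝ F]

lemma hasFDerivWithinAt_slice {f : V × W → F} {A : V × W →L[ℝ] F} {C : Set (V × W)} {s : Set W}
    {c : V} {w : W} (h : HasFDerivWithinAt f A C (c, w)) (hs : ∀ y ∈ s, (c, y) ∈ C) :
    HasFDerivWithinAt (fun y => f (c, y)) (A.comp (ContinuousLinearMap.inr ℝ V W)) s w :=
  h.comp w (hasFDerivAt_prodMk_right c w).hasFDerivWithinAt hs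

lemma IsC1SubmersionOn.surjective_fderivWithin {f : W → F} {C : Set W}
    (h : IsC1SubmersionOn f C) (hC : UniqueDiffOn ℝ C) {z : W} (hz : z ∈ C) :
    Function.Surjective (fderivWithin ℝ f C z) := by
  obtain ⟨f', hf', hs⟩ := h.2 z hz
  rw [hf'.fderivWithin (hC z hz)]
  refine (LinearMap.range_eq_top (f := (f' : W →ₗ[ℝ] F))).1 (top_le_iff.1 ?_)
  rw [← hs]
  exact LinearMap.map_le_range

variable [FiniteDimensional ℝ V] [FiniteDimensional ℝ W] [FiniteDimensional ℝ F]
  [MeasurableSpace V] [BorelSpace V] (μ : Measure V) [μ.IsAddHaarMeasure]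

/-- The two sets play different roles: `f` is `C¹` on the convex set `C`, while submersivity is
known only on the part `N`, which may be thin. -/
lemma ae_injective_fderivWithin (hdim : Module.finrank ℝ W = Module.finrank ℝ F)
    {C N : Set (V × W)} (hC : Convex ℝ C) (hC' : UniqueDiffOn ℝ C) {f : V × W → F}
    (hf : ContDiffOn ℝ 1 f C) (hNC : N ⊆ C)
    (hN : ∀ z ∈ N, f z = 0 → Function.Surjective (fderivWithin ℝ f C z)) :
    ∀ᵐ c ∂μ, ∀ w, (c, w) ∈ N → f (c, w) = 0 → Function.Injective
      ((fderivWithin ℝ f C (c, w)).comp (ContinuousLinearMap.inr ℝ V W)) := by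
  have h := measure_fst_image_degenerate_zeros μ hdim hC
    (M := {z | z ∈ N ∧ f z = 0 ∧ ∃ w : W, w ≠ 0 ∧ fderivWithin ℝ f C z (0, w) = 0})
    (fun z hz => (hf.differentiableOn (by norm_num) z hz).hasFDerivWithinAt)
    (hf.continuousOn_fderivWithin hC' le_rfl) (fun z hz => hNC hz.1)
    (fun z hz => ⟨hz.2.1, hN z hz.1 hz.2.1, hz.2.2⟩)
  refine measure_mono_null (fun c hc => ?_) h
  by_contra hcon
  refine hc fun w hw h0 => (injective_iff_map_eq_zero _).2 fun y hy => ?_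
  by_contra hy0
  exact hcon ⟨(c, w), ⟨hw, h0, y, hy0, hy⟩, rfl⟩

end Generic

section Equilibria

variable {V : Type*} [NormedAddCommGroup V] [NormedSpace ℝ V]
  {d : ℕ} {X : Set (Euc d)} {e : V × Euc d → Euc d}

/-- On tangent directions of `S` the derivative of `f` is `(f', 0)`, since `n = ν` and `ρ = 0` along
`∂X`; their span therefore reaches every `(u, 0)`. A direction in `x` with `dρ(w) = s` supplies the
last coordinate, and a tangent vector corrects the first. -/
lemma surjective_fderivWithin_boundary {C : Set (V × Euc d × ℝ)} {U : Set (Euc d)}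
    (hU : IsOpen U) {ρ : Euc d → ℝ} {ν : Euc d → Euc d}
    (hρ : ContDiffOn ℝ 1 ρ U) (hρ0 : ∀ x ∈ U, fderiv ℝ ρ x ≠ 0)
    (hbd : ∀ x ∈ U ∩ frontier X, ρ x = 0 ∧ outwardNormal X x = ν x)
    (hC : UniqueDiffOn ℝ C)
    (hUC : ∀ z : V × Euc d × ℝ, z.2.1 ∈ U → z.2.1 ∈ frontier X → z ∈ C)
    {f : V × Euc d × ℝ → Euc d × ℝ}
    (hfdef : f = fun z => (e (z.1, z.2.1) - z.2.2 • ν z.2.1, ρ z.2.1))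
    (hf : ContDiffOn ℝ 1 f C)
    (h : IsC1SubmersionOn
      (fun z : V × Euc d × ℝ => e (z.1, z.2.1) - z.2.2 • outwardNormal X z.2.1)
      (univ ×ˢ (frontier X ×ˢ Ici (0 : ℝ))))
    {z : V × Euc d × ℝ} (hzU : z.2.1 ∈ U) (hzX : z.2.1 ∈ frontier X) (hz0 : 0 ≤ z.2.2) :
    Function.Surjective (fderivWithin ℝ f C z) := by
  set S : Set (V × Euc d × ℝ) := univ ×ˢ (frontier X ×ˢ Ici (0 : ℝ)) with hS
  have hzS : z ∈ S := ⟨mem_univ _, hzX, hz0⟩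
  have hzC : z ∈ C := hUC z hzU hzX
  obtain ⟨f', hf', hsurj⟩ := h.2 z hzS
  set A := fderivWithin ℝ f C z with hA
  have hAC : HasFDerivWithinAt f A C z :=
    (hf.differentiableOn (by norm_num) z hzC).hasFDerivWithinAt
  have hO : {y : V × Euc d × ℝ | y.2.1 ∈ U} ∈ 𝓝 z :=
    (hU.preimage (by fun_prop : Continuous fun y : V × Euc d × ℝ => y.2.1)).mem_nhds hzU
  have hAS : HasFDerivWithinAt f A S z :=
    (hasFDerivWithinAt_inter hO).1 (hAC.mono fun y hy => hUC y hy.2 hy.1.2.1)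
  have hev : ∀ᶠ y in 𝓝[S] z, y.2.1 ∈ U ∩ frontier X := by
    filter_upwards [mem_nhdsWithin_of_mem_nhds hO, self_mem_nhdsWithin] with y h1 h2
    exact ⟨h1, h2.2.1⟩
  have hA1 : EqOn (fun y => (A y).1) f' (tangentConeAt ℝ S z) := by
    have h1 : HasFDerivWithinAt (fun y => (f y).1)
        ((ContinuousLinearMap.fst ℝ (Euc d) ℝ).comp A) S z := hAS.fst
    have h2 : (fun z : V × Euc d × ℝ => e (z.1, z.2.1) - z.2.2 • outwardNormal X z.2.1)
        =ᶠ[𝓝[S] z] fun y => (f y).1 := by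
      filter_upwards [hev] with y hy
      simp only [hfdef, (hbd _ hy).2]
    exact (h1.congr_of_eventuallyEq h2 (h2.self_of_nhdsWithin hzS)).unique_on hf'
  have hA2 : EqOn (fun y => (A y).2) 0 (tangentConeAt ℝ S z) := by
    have h1 : HasFDerivWithinAt (fun y => (f y).2)
        ((ContinuousLinearMap.snd ℝ (Euc d) ℝ).comp A) S z := hAS.snd
    have h2 : HasFDerivWithinAt (fun _ : V × Euc d × ℝ => (0 : ℝ))
        (0 : V × Euc d × ℝ →L[ℝ] ℝ) S z :=
      hasFDerivWithinAt_const (0 : ℝ) z S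
    have h3 : (fun _ : V × Euc d × ℝ => (0 : ℝ)) =ᶠ[𝓝[S] z] fun y => (f y).2 := by
      filter_upwards [hev] with y hy
      simp only [hfdef, (hbd _ hy).1]
    exact (h1.congr_of_eventuallyEq h3 (h3.self_of_nhdsWithin hzS)).unique_on h2
  have hA3 : ∀ y, (A y).2 = fderiv ℝ ρ z.2.1 y.2.1 := by
    have h1 : HasFDerivWithinAt (fun y => (f y).2)
        ((ContinuousLinearMap.snd ℝ (Euc d) ℝ).comp A) C z := hAC.snd
    have h2 : HasFDerivWithinAt (fun y : V × Euc d × ℝ => ρ y.2.1)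
        ((fderiv ℝ ρ z.2.1).comp ((ContinuousLinearMap.fst ℝ (Euc d) ℝ).comp
          (ContinuousLinearMap.snd ℝ V (Euc d × ℝ)))) C z := by
      have h3 := ((hρ.contDiffAt (hU.mem_nhds hzU)).differentiableAt (by norm_num)).hasFDerivAt
      exact (h3.comp z ((ContinuousLinearMap.fst ℝ (Euc d) ℝ).comp
          (ContinuousLinearMap.snd ℝ V (Euc d × ℝ))).hasFDerivAt).hasFDerivWithinAt
    have h4 : (fun y => (f y).2) = fun y : V × Euc d × ℝ => ρ y.2.1 := by rw [hfdef]
    rw [h4] at h1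
    intro y
    exact DFunLike.congr_fun ((hC z hzC).eq h1 h2) y
  rintro ⟨u, s⟩
  obtain ⟨w, hw⟩ : ∃ w, fderiv ℝ ρ z.2.1 w = s := by
    obtain ⟨w, hw⟩ : ∃ w, fderiv ℝ ρ z.2.1 w ≠ 0 := by
      by_contra! hcon
      exact hρ0 _ hzU (ContinuousLinearMap.ext hcon)
    exact ⟨(s / fderiv ℝ ρ z.2.1 w) • w, by rw [map_smul, smul_eq_mul, div_mul_cancel₀ _ hw]⟩
  set w₀ : V × Euc d × ℝ := (0, w, 0) with hw₀
  obtain ⟨k, hk, hk'⟩ : u - (A w₀).1 ∈ (Submodule.span ℝ (tangentConeAt ℝ S z)).map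
      (f' : V × Euc d × ℝ →ₗ[ℝ] Euc d) := by rw [hsurj]; trivial
  have hk1 : (A k).1 = f' k := by
    have := LinearMap.eqOn_span (f := ((ContinuousLinearMap.fst ℝ (Euc d) ℝ).comp A : _ →ₗ[ℝ] _))
      (g := (f' : V × Euc d × ℝ →ₗ[ℝ] Euc d)) hA1 hk
    exact this
  have hk2 : (A k).2 = 0 := by
    have := LinearMap.eqOn_span (f := ((ContinuousLinearMap.snd ℝ (Euc d) ℝ).comp A : _ →ₗ[ℝ] _))
      (g := (0 : V × Euc d × ℝ →ₗ[ℝ] ℝ)) hA2 hk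
    exact this
  refine ⟨w₀ + k, ?_⟩
  rw [map_add]
  refine Prod.ext ?_ ?_
  · change (A w₀).1 + (A k).1 = u
    rw [hk1]
    change f' k = _ at hk'
    rw [hk']; abel
  · change (A w₀).2 + (A k).2 = s
    rw [hk2, hA3, add_zero]; exact hw

variable [FiniteDimensional ℝ V] [MeasurableSpace V] [BorelSpace V] (μ : Measure V)
  [μ.IsAddHaarMeasure]

/-- The system `e = α ν`, `ρ = 0` is square in `(x, α)`. It is studied on `X ∩ B` with `B` a ball,
which keeps the domain convex, and with all real `α`. The exceptional null set depends only on `x₀`,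
so finitely many such neighbourhoods can be combined. -/
lemma exists_nhds_ae_boundary_isolated (hX : IsC2ConvexBody X)
    (he : ContDiffOn ℝ 1 e (univ ×ˢ X))
    (h : IsC1SubmersionOn
      (fun z : V × Euc d × ℝ => e (z.1, z.2.1) - z.2.2 • outwardNormal X z.2.1)
      (univ ×ˢ (frontier X ×ˢ Ici (0 : ℝ))))
    {x₀ : Euc d} (hx₀ : x₀ ∈ frontier X) :
    ∃ B ∈ 𝓝 x₀, ∀ᵐ c ∂μ, ∀ x ∈ frontier X ∩ B, ∀ α : ℝ, 0 ≤ α → ∀ᶠ z in 𝓝 (x, α),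
      z ∈ {z : Euc d × ℝ | z.1 ∈ frontier X ∧ 0 ≤ z.2 ∧
        e (c, z.1) = z.2 • outwardNormal X z.1} → z = (x, α) := by
  obtain ⟨U, ρ, ν, hU, hxU, hρ, hν, hρ0, hbd⟩ := hX.exists_local hx₀
  obtain ⟨r, hr, hball⟩ := Metric.isOpen_iff.1 hU x₀ hxU
  set B := Metric.ball x₀ r with hB
  have hBo : IsOpen B := Metric.isOpen_ball
  set s : Set (Euc d × ℝ) := (X ∩ B) ×ˢ univ with hs
  set C : Set (V × Euc d × ℝ) := univ ×ˢ s with hC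
  set f : V × Euc d × ℝ → Euc d × ℝ :=
    fun z => (e (z.1, z.2.1) - z.2.2 • ν z.2.1, ρ z.2.1) with hf
  have hXB : Convex ℝ (X ∩ B) := hX.convex.inter (convex_ball _ _)
  have hint : (interior (X ∩ B)).Nonempty := by
    rw [interior_inter, hBo.interior_eq]
    have : x₀ ∈ closure (interior X) := by
      rw [hX.convex.closure_interior_eq_closure_of_nonempty_interior hX.interior_nonempty]
      exact hx₀.1
    rw [inter_comm]
    exact mem_closure_iff.1 this B hBo (Metric.mem_ball_self hr)
  have hCconv : Convex ℝ C := convex_univ.prod (hXB.prod convex_univ)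
  have hCu : UniqueDiffOn ℝ C :=
    uniqueDiffOn_univ.prod ((uniqueDiffOn_convex hXB hint).prod uniqueDiffOn_univ)
  have hfC : ContDiffOn ℝ 1 f C := by
    have hx : ContDiffOn ℝ 1 (fun z : V × Euc d × ℝ => z.2.1) C := by fun_prop
    have hα : ContDiffOn ℝ 1 (fun z : V × Euc d × ℝ => z.2.2) C := by fun_prop
    have h1 : ContDiffOn ℝ 1 (fun z : V × Euc d × ℝ => e (z.1, z.2.1)) C :=
      he.comp (g := e) (f := fun z : V × Euc d × ℝ => (z.1, z.2.1)) (by fun_prop)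
        fun z hz => ⟨mem_univ _, hz.2.1.1⟩
    have h2 : ContDiffOn ℝ 1 (fun z : V × Euc d × ℝ => ν z.2.1) C :=
      hν.comp hx fun z hz => hball hz.2.1.2
    have h3 : ContDiffOn ℝ 1 (fun z : V × Euc d × ℝ => ρ z.2.1) C :=
      hρ.comp hx fun z hz => hball hz.2.1.2
    exact (h1.sub (hα.smul h2)).prodMk h3
  have hae := ae_injective_fderivWithin μ (by simp) hCconv hCu
    (N := {z | z ∈ C ∧ z.2.1 ∈ frontier X ∧ 0 ≤ z.2.2}) hfC (fun z hz => hz.1)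
    (fun z hz _ => surjective_fderivWithin_boundary hBo (hρ.mono hball)
      (fun x hx => hρ0 x (hball hx))
      (fun x hx => ⟨(hbd x ⟨hball hx.1, hx.2⟩).1, (hbd x ⟨hball hx.1, hx.2⟩).2.1⟩) hCu
      (fun z h1 h2 => ⟨mem_univ _, ⟨hX.isClosed.frontier_subset h2, h1⟩, mem_univ _⟩) hf hfC h
      hz.1.2.1.2 hz.2.1 hz.2.2)
  refine ⟨B, Metric.ball_mem_nhds _ hr, ?_⟩
  filter_upwards [hae] with c hc x hx α hα
  have hxC : ((c, x, α) : V × Euc d × ℝ) ∈ C :=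
    ⟨mem_univ _, ⟨hX.isClosed.frontier_subset hx.1, hx.2⟩, mem_univ _⟩
  have hder := hasFDerivWithinAt_slice (s := s)
    (hfC.differentiableOn (by norm_num) _ hxC).hasFDerivWithinAt fun y hy => ⟨mem_univ _, hy⟩
  refine eventually_eq_of_hasFDerivWithinAt hder (fun h0 => hc _ ⟨hxC, hx.1, hα⟩ h0) ?_
  have hO : {y : Euc d × ℝ | y.1 ∈ B} ∈ 𝓝 (x, α) :=
    (hBo.preimage continuous_fst).mem_nhds hx.2
  filter_upwards [hO] with z hz hzZ
  have hb := hbd z.1 ⟨hball hz, hzZ.1⟩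
  refine ⟨⟨⟨hX.isClosed.frontier_subset hzZ.1, hz⟩, mem_univ _⟩, ?_⟩
  simp only [hf, Prod.mk_eq_zero]
  exact ⟨by rw [hzZ.2.2, hb.2.1, sub_self], hb.1⟩

/-- For almost every parameter, a `C¹` family of fields that is submersive in the interior and
along the boundary has finitely many equilibria. -/
theorem ae_finite_equilibria (hX : IsC2ConvexBody X) (h₁ : IsC1SubmersionOn e (univ ×ˢ X))
    (h₂ : IsC1SubmersionOn
      (fun z : V × Euc d × ℝ => e (z.1, z.2.1) - z.2.2 • outwardNormal X z.2.1)
      (univ ×ˢ (frontier X ×ˢ Ici (0 : ℝ)))) :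
    ∀ᵐ c ∂μ, {x | x ∈ X ∧ e (c, x) ∈ normalCone X x}.Finite := by
  have hcpt := hX.isCompact
  have hfr : IsCompact (frontier X) := hcpt.of_isClosed_subset isClosed_frontier
    hX.isClosed.frontier_subset
  have hCu : UniqueDiffOn ℝ ((univ : Set V) ×ˢ X) :=
    uniqueDiffOn_univ.prod (uniqueDiffOn_convex hX.convex hX.interior_nonempty)
  have hae := ae_injective_fderivWithin μ rfl (convex_univ.prod hX.convex) hCu h₁.1 subset_rfl
    fun z hz _ => h₁.surjective_fderivWithin hCu hz
  have hloc := fun x₀ (hx₀ : x₀ ∈ frontier X) => exists_nhds_ae_boundary_isolated μ hX h₁.1 h₂ hx₀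
  choose! B hB hBae using hloc
  obtain ⟨t, ht, hcov⟩ := hfr.elim_nhds_subcover B hB
  have hae' := (ae_ball_iff t.countable_toSet).2 fun x₀ hx₀ => hBae x₀ (ht x₀ hx₀)
  filter_upwards [hae, hae'] with c hc hc'
  have hfin1 : {x | x ∈ X ∧ e (c, x) = 0}.Finite := by
    refine finite_of_eventually_eq hcpt (fun x hx => hx.1) fun x hx => ?_
    have hder := hasFDerivWithinAt_slice (s := X) (c := c) (w := x)
      (h₁.1.differentiableOn (by norm_num) _ ⟨mem_univ _, hx⟩).hasFDerivWithinAt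
      fun y hy => ⟨mem_univ _, hy⟩
    exact eventually_eq_of_hasFDerivWithinAt hder (fun h0 => hc x ⟨mem_univ _, hx⟩ h0)
      (Eventually.of_forall fun z hz => hz)
  have hcont : ContinuousOn (fun x => e (c, x)) X :=
    h₁.1.continuousOn.comp (by fun_prop) fun x hx => ⟨mem_univ _, hx⟩
  -- As `n` is a unit vector, `e = α n` forces `α ≤ R`, which makes the space of boundary solutions
  -- compact.
  obtain ⟨R, hR⟩ := hcpt.exists_bound_of_continuousOn hcont
  have hnorm : ∀ x ∈ frontier X, ‖outwardNormal X x‖ = 1 ∧ ∀ v ∈ normalCone X x,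
      ∃ α : ℝ, 0 ≤ α ∧ v = α • outwardNormal X x := by
    intro x hx
    obtain ⟨U, ρ, ν, -, hxU, -, -, -, hbd⟩ := hX.exists_local hx
    obtain ⟨-, h2, h3, h4⟩ := hbd x ⟨hxU, hx⟩
    rw [h2]; exact ⟨h3, h4⟩
  have hfin2 : {z : Euc d × ℝ | z.1 ∈ frontier X ∧ 0 ≤ z.2 ∧
      e (c, z.1) = z.2 • outwardNormal X z.1}.Finite := by
    refine finite_of_eventually_eq (hfr.prod (isCompact_Icc (a := (0 : ℝ)) (b := R))) ?_ ?_
    · rintro ⟨x, α⟩ ⟨hx, hα, hxα⟩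
      refine ⟨hx, hα, ?_⟩
      have := hR x (hX.isClosed.frontier_subset hx)
      simp only at hx hα hxα
      rwa [hxα, norm_smul, (hnorm x hx).1, mul_one, Real.norm_of_nonneg hα] at this
    · rintro ⟨x, α⟩ ⟨hx, hα⟩
      obtain ⟨x₀, hx₀, hxB⟩ := mem_iUnion₂.1 (hcov hx)
      exact hc' x₀ hx₀ x ⟨hx, hxB⟩ α hα.1
  refine (hfin1.union (hfin2.image Prod.fst)).subset ?_
  rintro x ⟨hx, hxN⟩
  by_cases hxi : x ∈ interior X
  · exact Or.inl ⟨hx, eq_zero_of_mem_normalCone_of_mem_interior hxi hxN⟩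
  · have hxf : x ∈ frontier X := by rw [hX.isClosed.frontier_eq]; exact ⟨hx, hxi⟩
    obtain ⟨α, hα, hv⟩ := (hnorm x hxf).2 _ hxN
    exact Or.inr ⟨(x, α), ⟨hxf, hα, hv⟩, rfl⟩

end Equilibria

/-! ## Prevalence from a submersion probe -/

section Probe

variable {d : ℕ} {X : Set (Euc d)} {𝒬 : Type*} [AddCommGroup 𝒬] [Module ℝ 𝒬] {ev : 𝒬 → X → Euc d}

theorem prevalent_of_isSubmersionProbe (hX : IsC2ConvexBody X) (hev : ∀ Q, IsC1Field X (ev Q))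
    {P : Submodule ℝ 𝒬} [hP : FiniteDimensional ℝ P] (h : IsSubmersionProbe X ev P) :
    Prevalent {Q : 𝒬 | HasFinitelyManyRTS X (ev Q)} := by
  refine ⟨P, hP, fun Q => ?_⟩
  filter_upwards [ae_finite_equilibria volume hX (h Q).1 (h Q).2] with c hc
  refine (hev _).hasFinitelyManyRTS hX ?_
  refine (hc.preimage Subtype.val_injective.injOn).subset fun x hx => ⟨x.2, ?_⟩
  simp only [perturbedEval, extendField_apply]
  exact hx

end Probe

/-! ## Spaces of fields with pointwise operations -/

section Pointwise

/-- All vectors `(k, 0)` are tangent, whatever `T` looks like near `w`, and on them `f'` is the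
partial derivative `ψ`. -/
lemma map_span_tangentConeAt_eq_top {V W F : Type*} [NormedAddCommGroup V] [NormedSpace ℝ V]
    [NormedAddCommGroup W] [NormedSpace ℝ W] [NormedAddCommGroup F] [NormedSpace ℝ F]
    {f : V × W → F} {f' : V × W →L[ℝ] F} {T : Set W} {c : V} {w : W} (hw : w ∈ T)
    (hf : HasFDerivWithinAt f f' (univ ×ˢ T) (c, w)) {ψ : V →L[ℝ] F}
    (hψ : HasFDerivAt (fun y => f (y, w)) ψ c) (hs : Function.Surjective ψ) :
    (Submodule.span ℝ (tangentConeAt ℝ (univ ×ˢ T) (c, w))).map (f' : V × W →ₗ[ℝ] F) = ⊤ := by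
  have h1 : HasFDerivWithinAt (fun y => f (y, w))
      (f'.comp (ContinuousLinearMap.inl ℝ V W)) univ c :=
    hf.comp c (hasFDerivAt_prodMk_left c w).hasFDerivWithinAt
      (show MapsTo (fun y => (y, w)) univ (univ ×ˢ T) from fun y _ => ⟨mem_univ _, hw⟩)
  have h2 := (hasFDerivWithinAt_univ.1 h1).unique hψ
  rw [eq_top_iff]
  rintro u -
  obtain ⟨k, rfl⟩ := hs u
  refine ⟨(k, 0), Submodule.subset_span ?_, ?_⟩
  · refine subset_tangentConeAt_prod_left (subset_closure hw) ⟨k, ?_, rfl⟩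
    rw [tangentConeAt_univ]; trivial
  · rw [← h2]; rfl

variable {d : ℕ} {X : Set (Euc d)}

lemma IsC2ConvexBody.contDiffOn_outwardNormal (hX : IsC2ConvexBody X) :
    ContDiffOn ℝ 1 (outwardNormal X) (frontier X) := by
  intro x hx
  obtain ⟨U, ρ, ν, hU, hxU, -, hν, -, hbd⟩ := hX.exists_local hx
  refine ((hν.contDiffAt (hU.mem_nhds hxU)).contDiffWithinAt).congr_of_eventuallyEq ?_
    (hbd x ⟨hxU, hx⟩).2.1
  filter_upwards [mem_nhdsWithin_of_mem_nhds (hU.mem_nhds hxU), self_mem_nhdsWithin] with y h1 h2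
  exact (hbd y ⟨h1, h2⟩).2.1

variable {𝒬 : Type*} [AddCommGroup 𝒬] [Module ℝ 𝒬] {ev : 𝒬 → X → Euc d}

/-- Evaluation at `x` of the perturbations from `P`, in coordinates. -/
noncomputable def evalCoords (hlin : IsLinearMap ℝ ev) (P : Submodule ℝ 𝒬)
    [FiniteDimensional ℝ P] (x : X) : (Fin (Module.finrank ℝ P) → ℝ) →ₗ[ℝ] Euc d :=
  (LinearMap.proj x).comp ((hlin.mk' ev).comp (P.subtype.comp (coords P : _ →ₗ[ℝ] P)))

lemma perturbedEval_eq (hlin : IsLinearMap ℝ ev) (P : Submodule ℝ 𝒬) [FiniteDimensional ℝ P]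
    (Q : 𝒬) (c : Fin (Module.finrank ℝ P) → ℝ) (x : X) :
    perturbedEval X ev P Q (c, x) = ev Q x + evalCoords hlin P x c := by
  simp only [perturbedEval, extendField_apply, hlin.map_add]
  rfl

lemma contDiffOn_perturbedEval (hlin : IsLinearMap ℝ ev) (hev : ∀ Q, IsC1Field X (ev Q))
    (P : Submodule ℝ 𝒬) [FiniteDimensional ℝ P] (Q : 𝒬) :
    ContDiffOn ℝ 1 (perturbedEval X ev P Q) (univ ×ˢ X) := by
  have hsnd : MapsTo (fun z : (Fin (Module.finrank ℝ P) → ℝ) × Euc d => z.2) (univ ×ˢ X) X :=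
    fun z hz => hz.2
  have hcomp : ∀ R : 𝒬, ContDiffOn ℝ 1
      (fun z : (Fin (Module.finrank ℝ P) → ℝ) × Euc d => extendField X (ev R) z.2) (univ ×ˢ X) :=
    fun R => ContDiffOn.comp (hev R) (by fun_prop) hsnd
  have h : ContDiffOn ℝ 1 (fun z : (Fin (Module.finrank ℝ P) → ℝ) × Euc d =>
      -- Joint smoothness: linearity writes the family as a finite sum of coordinates times fixed
      -- `C¹` fields.
      extendField X (ev Q) z.2 + ∑ i, z.1 i •
        extendField X (ev (coords P fun j => if i = j then 1 else 0 : 𝒬)) z.2) (univ ×ˢ X) := by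
    refine (hcomp Q).add (ContDiffOn.sum fun i _ => ?_)
    have hi : ContDiffOn ℝ 1 (fun z : (Fin (Module.finrank ℝ P) → ℝ) × Euc d => z.1 i)
      (univ ×ˢ X) := by fun_prop
    exact hi.smul (hcomp _)
  refine h.congr ?_
  rintro ⟨c, x⟩ ⟨-, hx⟩
  rw [perturbedEval_eq hlin P Q c ⟨x, hx⟩, LinearMap.pi_apply_eq_sum_univ]
  simp only [extendField_of_mem _ hx]
  rfl

lemma isSubmersionProbe_of_evalIsSubmersion (hX : IsC2ConvexBody X) (hlin : IsLinearMap ℝ ev)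
    (hev : ∀ Q, IsC1Field X (ev Q)) (P : Submodule ℝ 𝒬) [FiniteDimensional ℝ P]
    (hP : EvalIsSubmersion X ev P) : IsSubmersionProbe X ev P := by
  intro Q
  have hC := contDiffOn_perturbedEval hlin hev P Q
  have hsurj : ∀ x, Function.Surjective (LinearMap.toContinuousLinearMap (evalCoords hlin P x)) := by
    intro x
    obtain ⟨f', hf', hs⟩ := (hP x).2 0 (mem_univ _)
    have h1 := (hasFDerivWithinAt_univ.1 hf').unique
      (LinearMap.toContinuousLinearMap (evalCoords hlin P x)).hasFDerivAt
    rw [← h1]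
    refine (LinearMap.range_eq_top (f := (f' : (Fin (Module.finrank ℝ P) → ℝ) →ₗ[ℝ] Euc d))).1 (top_le_iff.1 ?_)
    rw [← hs]
    exact LinearMap.map_le_range
  have hslice : ∀ (x : X) (c : Fin (Module.finrank ℝ P) → ℝ),
      HasFDerivAt (fun c => perturbedEval X ev P Q (c, x))
        (LinearMap.toContinuousLinearMap (evalCoords hlin P x)) c := by
    intro x c
    simp only [perturbedEval_eq hlin P Q _ x]
    exact (LinearMap.toContinuousLinearMap (evalCoords hlin P x)).hasFDerivAt.const_add _
  refine ⟨⟨hC, ?_⟩, ?_, ?_⟩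
  · rintro ⟨c, x⟩ hz
    have hd := (hC.differentiableOn (by norm_num) _ hz).hasFDerivWithinAt
    exact ⟨_, hd, map_span_tangentConeAt_eq_top hz.2 hd (hslice ⟨x, hz.2⟩ c) (hsurj _)⟩
  all_goals
    have hC' : ContDiffOn ℝ 1 (perturbedEvalTilde X ev P Q)
        (univ ×ˢ (frontier X ×ˢ Ici (0 : ℝ))) := by
      have h1 : ContDiffOn ℝ 1 (fun z : (Fin (Module.finrank ℝ P) → ℝ) × Euc d × ℝ =>
          perturbedEval X ev P Q (z.1, z.2.1)) (univ ×ˢ (frontier X ×ˢ Ici (0 : ℝ))) :=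
        hC.comp (g := perturbedEval X ev P Q)
          (f := fun z : (Fin (Module.finrank ℝ P) → ℝ) × Euc d × ℝ => (z.1, z.2.1)) (by fun_prop)
          fun z hz => ⟨mem_univ _, hX.isClosed.frontier_subset hz.2.1⟩
      have h2 : ContDiffOn ℝ 1 (fun z : (Fin (Module.finrank ℝ P) → ℝ) × Euc d × ℝ =>
          outwardNormal X z.2.1) (univ ×ˢ (frontier X ×ˢ Ici (0 : ℝ))) :=
        hX.contDiffOn_outwardNormal.comp
          (f := fun z : (Fin (Module.finrank ℝ P) → ℝ) × Euc d × ℝ => z.2.1) (by fun_prop)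
          fun z hz => hz.2.1
      have h3 : ContDiffOn ℝ 1 (fun z : (Fin (Module.finrank ℝ P) → ℝ) × Euc d × ℝ => z.2.2)
        (univ ×ˢ (frontier X ×ˢ Ici (0 : ℝ))) := by fun_prop
      exact h1.sub (h3.smul h2)
  · exact hC'
  · rintro ⟨c, x, α⟩ hz
    have hd := (hC'.differentiableOn (by norm_num) _ hz).hasFDerivWithinAt
    have hx : x ∈ X := hX.isClosed.frontier_subset hz.2.1
    have hs := (hslice ⟨x, hx⟩ c).sub_const (α • outwardNormal X x)
    exact ⟨_, hd, map_span_tangentConeAt_eq_top hz.2 hd hs (hsurj _)⟩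

lemma exists_isSubmersionProbe (hX : IsC2ConvexBody X) (hlin : IsLinearMap ℝ ev)
    (hev : ∀ Q, IsC1Field X (ev Q)) (hconst : ContainsConstants X ev) :
    ∃ (P : Submodule ℝ 𝒬) (_ : FiniteDimensional ℝ P), IsSubmersionProbe X ev P := by
  -- The probe is spanned by fields that are constantly the standard basis vectors, so `∑ i, u i • R
  -- i` evaluates to `u` everywhere.
  choose R hR using fun i : Fin d => hconst (EuclideanSpace.single i 1)
  refine ⟨Submodule.span ℝ (range R), FiniteDimensional.span_of_finite ℝ (finite_range R), ?_⟩
  have : FiniteDimensional ℝ (Submodule.span ℝ (range R)) :=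
    FiniteDimensional.span_of_finite ℝ (finite_range R)
  refine isSubmersionProbe_of_evalIsSubmersion hX hlin hev _ fun x => ?_
  set Ψ := LinearMap.toContinuousLinearMap (evalCoords hlin (Submodule.span ℝ (range R)) x) with hΨ
  refine ⟨Ψ.contDiff.contDiffOn, fun c _ => ⟨Ψ, Ψ.hasFDerivWithinAt, ?_⟩⟩
  rw [tangentConeAt_univ, Submodule.span_univ, Submodule.map_top, LinearMap.range_eq_top]
  intro u
  have hmem : ∑ i, u i • R i ∈ Submodule.span ℝ (range R) :=
    Submodule.sum_mem _ fun i _ => Submodule.smul_mem _ _ (Submodule.subset_span ⟨i, rfl⟩)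
  refine ⟨(coords _).symm ⟨_, hmem⟩, ?_⟩
  change ev ((coords _ ((coords (Submodule.span ℝ (range R))).symm ⟨_, hmem⟩) : _) : 𝒬) x = u
  rw [LinearEquiv.apply_symm_apply]
  change (hlin.mk' ev) (∑ i, u i • R i) x = u
  rw [map_sum, Finset.sum_apply]
  simp only [map_smul, Pi.smul_apply, IsLinearMap.mk'_apply, hR]
  ext j
  simp [Finset.sum_apply, Pi.single_apply]

end Pointwise

/-! ## Complete spaces of `C¹` fields -/

section C1

/-- Apply the mean value inequality on the convex set to `f n - f N` and let `n → ∞`; this compares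
`g` with the fixed `f N` to first order. Pointwise convergence of the functions is then enough. -/
lemma hasFDerivWithinAt_of_tendsto {E F : Type*} [NormedAddCommGroup E] [NormedSpace ℝ E]
    [NormedAddCommGroup F] [NormedSpace ℝ F] {s : Set E} (hs : Convex ℝ s) {f : ℕ → E → F}
    {f' : ℕ → E → E →L[ℝ] F} {g : E → F} {g' : E → E →L[ℝ] F}
    (hf : ∀ n, ∀ x ∈ s, HasFDerivWithinAt (f n) (f' n x) s x)
    (hg : ∀ x ∈ s, Tendsto (fun n => f n x) atTop (𝓝 (g x)))
    (hg' : ∀ ε > 0, ∀ᶠ n in atTop, ∀ x ∈ s, ‖f' n x - g' x‖ ≤ ε) {x : E} (hx : x ∈ s) :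
    HasFDerivWithinAt g (g' x) s x := by
  rw [hasFDerivWithinAt_iff_isLittleO, Asymptotics.isLittleO_iff]
  intro ε hε
  obtain ⟨N, hN⟩ := eventually_atTop.1 (hg' (ε / 4) (by positivity))
  have hd := (hf N x hx).isLittleO.def (show 0 < ε / 4 by positivity)
  filter_upwards [hd, self_mem_nhdsWithin] with y hy hys
  have h1 : ‖(g y - f N y) - (g x - f N x)‖ ≤ ε / 2 * ‖y - x‖ := by
    have hlim : Tendsto (fun n => ‖(f n y - f N y) - (f n x - f N x)‖) atTop
        (𝓝 ‖(g y - f N y) - (g x - f N x)‖) :=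
      (((hg y hys).sub_const _).sub ((hg x hx).sub_const _)).norm
    refine le_of_tendsto hlim ?_
    filter_upwards [eventually_ge_atTop N] with n hn
    refine hs.norm_image_sub_le_of_norm_hasFDerivWithin_le (f := fun z => f n z - f N z)
      (fun z hz => (hf n z hz).sub (hf N z hz)) (fun z hz => ?_) hx hys
    have := norm_sub_le_norm_sub_add_norm_sub (f' n z) (g' z) (f' N z)
    rw [norm_sub_rev (g' z)] at this
    linarith [hN n hn z hz, hN N le_rfl z hz]
  have h2 : ‖f N y - f N x - (f' N x) (y - x)‖ ≤ ε / 4 * ‖y - x‖ := hy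
  have h3 : ‖(f' N x - g' x) (y - x)‖ ≤ ε / 4 * ‖y - x‖ :=
    ((f' N x - g' x).le_opNorm _).trans
      (mul_le_mul_of_nonneg_right (hN N le_rfl x hx) (norm_nonneg _))
  have e : g y - g x - (g' x) (y - x) = ((g y - f N y) - (g x - f N x)) +
      (f N y - f N x - (f' N x) (y - x)) + (f' N x - g' x) (y - x) := by
    rw [sub_apply]; abel
  rw [e]
  refine (norm_add₃_le).trans ?_
  linarith

/-- A vector space with an injective linear map of closed range into a Banach space is a complete
metric vector space under the induced distance. -/
lemma exists_metricSpace_of_isClosed_range {V B : Type*} [AddCommGroup V] [Module ℝ V]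
    [NormedAddCommGroup B] [NormedSpace ℝ B] [CompleteSpace B] (J : V →ₗ[ℝ] B)
    (hJ : Function.Injective J) (hcl : IsClosed (range J)) :
    ∃ m : MetricSpace V, (∀ Q R : V, m.dist Q R = ‖J Q - J R‖) ∧
      IsCompleteMetricVectorSpace V m := by
  let inst : NormedAddCommGroup V := NormedAddCommGroup.induced V B J hJ
  let inst' : NormedSpace ℝ V := NormedSpace.induced ℝ V B J
  have hiso : Isometry J := AddMonoidHomClass.isometry_of_norm J fun _ => rfl
  refine ⟨inst.toMetricSpace, fun Q R => (hiso.dist_eq Q R).symm.trans (dist_eq_norm _ _), ?_, ?_, ?_⟩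
  · exact (completeSpace_iff_isComplete_range hiso.isUniformInducing).2 hcl.isComplete
  · exact inferInstanceAs (IsTopologicalAddGroup V)
  · exact inferInstanceAs (ContinuousSMul ℝ V)

/-- Completeness of a space on which two linear families of continuous functions on a compact space
are given, under the sum of the two supremum distances. -/
lemma exists_metricSpace_of_uniform_limits {K E F V : Type*} [TopologicalSpace K] [CompactSpace K]
    [NormedAddCommGroup E] [NormedSpace ℝ E] [CompleteSpace E]
    [NormedAddCommGroup F] [NormedSpace ℝ F] [CompleteSpace F] [AddCommGroup V] [Module ℝ V]
    (a : V →ₗ[ℝ] K → E) (b : V →ₗ[ℝ] K → F) (ha : ∀ Q, Continuous (a Q))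
    (hb : ∀ Q, Continuous (b Q)) (hinj : Function.Injective a)
    (hcl : ∀ (R : ℕ → V) (g : K → E) (D : K → F), Continuous D →
      TendstoUniformly (fun n => a (R n)) g atTop → TendstoUniformly (fun n => b (R n)) D atTop →
      ∃ Q, a Q = g ∧ b Q = D) :
    ∃ m : MetricSpace V, (∀ Q R : V, m.dist Q R =
      (⨆ x, ‖a Q x - a R x‖) + ⨆ x, ‖b Q x - b R x‖) ∧ IsCompleteMetricVectorSpace V m := by
  -- The `ℓ¹` product makes the norm exactly the sum of the two suprema.
  let J : V →ₗ[ℝ] WithLp 1 (C(K, E) × C(K, F)) :=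
    { toFun := fun Q => WithLp.toLp 1 (⟨a Q, ha Q⟩, ⟨b Q, hb Q⟩)
      map_add' := fun Q R => by
        refine congrArg (WithLp.toLp 1) (Prod.ext ?_ ?_)
        · ext1 x; exact congrFun (map_add a Q R) x
        · ext1 x; exact congrFun (map_add b Q R) x
      map_smul' := fun c Q => by
        refine congrArg (WithLp.toLp 1) (Prod.ext ?_ ?_)
        · ext1 x; exact congrFun (map_smul a c Q) x
        · ext1 x; exact congrFun (map_smul b c Q) x }
  have hJ : Function.Injective J := fun Q R h => by
    have h1 := congrArg (fun z => (z.fst : K → E)) h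
    exact hinj h1
  obtain ⟨m, hm, hm'⟩ := exists_metricSpace_of_isClosed_range J hJ (by
    refine isClosed_of_closure_subset fun p hp => ?_
    obtain ⟨q, hq, hqp⟩ := mem_closure_iff_seq_limit.1 hp
    choose R hR using hq
    have hq' : q = fun n => J (R n) := funext fun n => (hR n).symm
    rw [hq'] at hqp
    have h1 := ((WithLp.continuous_fst 1 _ _).tendsto p).comp hqp
    have h2 := ((WithLp.continuous_snd 1 _ _).tendsto p).comp hqp
    rw [ContinuousMap.tendsto_iff_tendstoUniformly] at h1 h2
    obtain ⟨Q, hQ1, hQ2⟩ := hcl R p.fst p.snd p.snd.continuous h1 h2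
    refine ⟨Q, (WithLp.ofLp_injective 1) (Prod.ext ?_ ?_)⟩
    · ext1 x; exact congrFun hQ1 x
    · ext1 x; exact congrFun hQ2 x)
  refine ⟨m, fun Q R => ?_, hm'⟩
  rw [hm, WithLp.prod_norm_eq_of_L1, ContinuousMap.norm_eq_iSup_norm,
    ContinuousMap.norm_eq_iSup_norm]
  rfl

variable {d : ℕ} {X : Set (Euc d)}

lemma extendField_of_not_mem (Q : X → Euc d) {x : Euc d} (hx : x ∉ X) : extendField X Q x = 0 :=
  Function.extend_apply' _ _ _ fun ⟨y, hy⟩ => hx (hy ▸ y.2)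

lemma extendField_add (Q R : X → Euc d) :
    extendField X (Q + R) = extendField X Q + extendField X R := by
  funext x
  by_cases hx : x ∈ X
  · simp [extendField_of_mem _ hx]
  · simp [extendField_of_not_mem _ hx]

lemma extendField_smul (c : ℝ) (Q : X → Euc d) :
    extendField X (c • Q) = c • extendField X Q := by
  funext x
  by_cases hx : x ∈ X
  · simp [extendField_of_mem _ hx]
  · simp [extendField_of_not_mem _ hx]

lemma IsC2ConvexBody.uniqueDiffOn (hX : IsC2ConvexBody X) : UniqueDiffOn ℝ X :=
  uniqueDiffOn_convex hX.convex hX.interior_nonempty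

lemma IsC1Field.hasFDerivWithinAt {Q : X → Euc d} (hQ : IsC1Field X Q) {x : Euc d} (hx : x ∈ X) :
    HasFDerivWithinAt (extendField X Q) (fderivWithin ℝ (extendField X Q) X x) X x :=
  (ContDiffOn.differentiableOn hQ (by norm_num) x hx).hasFDerivWithinAt

lemma isC1Field_of_hasFDerivWithinAt (hX : IsC2ConvexBody X) {Q : X → Euc d}
    {D : X → Euc d →L[ℝ] Euc d} (hD : Continuous D) (h : ∀ x : X, HasFDerivWithinAt (extendField X Q) (D x) X x) :
    IsC1Field X Q := by
  have h1 := contDiffOn_succ_iff_fderivWithin (n := 0) (f := extendField X Q) hX.uniqueDiffOn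
  rw [zero_add] at h1
  refine h1.2 ⟨fun x hx => (h ⟨x, hx⟩).differentiableWithinAt, by simp, contDiffOn_zero.2 ?_⟩
  rw [continuousOn_iff_continuous_domRestrict]
  refine hD.congr fun x => ?_
  exact ((h x).fderivWithin (hX.uniqueDiffOn x x.2)).symm

/-- The derivatives of the fields of a space of `C¹` fields. -/
noncomputable def derivField (hX : IsC2ConvexBody X) (W : Submodule ℝ (X → Euc d))
    (hW : ∀ Q ∈ W, IsC1Field X Q) : W →ₗ[ℝ] X → Euc d →L[ℝ] Euc d where
  toFun Q x := fderivWithin ℝ (extendField X Q) X x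
  map_add' Q R := by
    funext x
    change fderivWithin ℝ (extendField X ((Q : X → Euc d) + R)) X x = _
    rw [extendField_add]
    exact (((hW Q Q.2).hasFDerivWithinAt x.2).add
      ((hW R R.2).hasFDerivWithinAt x.2)).fderivWithin (hX.uniqueDiffOn x x.2)
  map_smul' c Q := by
    funext x
    change fderivWithin ℝ (extendField X (c • (Q : X → Euc d))) X x = _
    rw [extendField_smul]
    exact (((hW Q Q.2).hasFDerivWithinAt x.2).const_smul c).fderivWithin (hX.uniqueDiffOn x x.2)

/-- A space of `C¹` fields that contains the constants is complete under the `C¹` distance as soon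
as it is closed under `C¹` limits. -/
theorem isCompleteC1Class_of_closed (hX : IsC2ConvexBody X) (W : Submodule ℝ (X → Euc d))
    (hW : ∀ Q ∈ W, IsC1Field X Q) (hconst : ContainsConstants X fun Q : W => (Q : X → Euc d))
    (hcl : ∀ (R : ℕ → W) (g : X → Euc d), IsC1Field X g →
      TendstoUniformly (fun n x => (R n : X → Euc d) x) g atTop → g ∈ W) :
    IsCompleteC1Class X W := by
  have : CompactSpace X := isCompact_iff_compactSpace.1 hX.isCompact
  refine ⟨hW, exists_metricSpace_of_uniform_limits W.subtype (derivField hX W hW)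
    (fun Q => (hW Q Q.2).continuous) (fun Q => continuousOn_iff_continuous_domRestrict.1
      (ContDiffOn.continuousOn_fderivWithin (hW Q Q.2) hX.uniqueDiffOn le_rfl))
    W.subtype_injective fun R g D hD h1 h2 => ?_, hconst⟩
  have hder : ∀ x : X, HasFDerivWithinAt (extendField X g) (D x) X x := by
    intro x
    have hext : ∀ y : X, Function.extend Subtype.val D 0 (y : Euc d) = D y :=
      fun y => Subtype.val_injective.extend_apply _ _ _
    rw [← hext]
    refine hasFDerivWithinAt_of_tendsto hX.convex
      (f := fun n => extendField X (R n))
      (f' := fun n => fderivWithin ℝ (extendField X (R n)) X)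
      (fun n y hy => (hW _ (R n).2).hasFDerivWithinAt hy) (fun y hy => ?_) (fun ε hε => ?_) x.2
    · simp only [extendField_of_mem _ hy]
      exact h1.tendsto_at ⟨y, hy⟩
    · filter_upwards [Metric.tendstoUniformly_iff.1 h2 ε hε] with n hn y hy
      have := (hn ⟨y, hy⟩).le
      rw [dist_comm, dist_eq_norm] at this
      rw [hext ⟨y, hy⟩]
      exact this
  have hgW : g ∈ W := hcl R g (isC1Field_of_hasFDerivWithinAt hX hD hder) h1
  exact ⟨⟨g, hgW⟩, rfl, funext fun x => (hder x).fderivWithin (hX.uniqueDiffOn x x.2)⟩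

end C1

/-! ## Gradient fields and Picard fields -/

section Examples

variable {d : ℕ} {X : Set (Euc d)}

/-- Adding the identity preserves `C¹`, so closedness under `C¹` limits is automatic for this space.
-/
lemma mem_picardFields {Q : X → Euc d} : Q ∈ picardFields X ↔ IsC1Field X Q := by
  constructor
  · rintro ⟨F, hF, hQ⟩
    refine (hF.sub contDiffOn_id).congr fun x hx => ?_
    rw [extendField_of_mem _ hx, hQ]; rfl
  · intro h
    refine ⟨fun x => extendField X Q x + x, ContDiffOn.add h contDiffOn_id, fun x => ?_⟩
    change Q x = extendField X Q x + x - x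
    rw [extendField_apply, add_sub_cancel_right]

theorem isCompleteC1Class_picardFields (hX : IsC2ConvexBody X) :
    IsCompleteC1Class X (picardFields X) :=
  isCompleteC1Class_of_closed hX _ (fun _ h => mem_picardFields.1 h)
    (fun u => ⟨⟨fun _ => u, fun x => u + x, contDiffOn_const.add contDiffOn_id, by simp⟩,
      fun _ => rfl⟩) fun _ _ hg _ => mem_picardFields.2 hg

lemma exists_dual_map (d : ℕ) : ∃ S : Euc d →L[ℝ] (Euc d →L[ℝ] ℝ),
    ∀ v : Euc d, S v = InnerProductSpace.toDual ℝ (Euc d) v := by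
  let S : Euc d →ₗ[ℝ] (Euc d →L[ℝ] ℝ) :=
    { toFun := InnerProductSpace.toDual ℝ (Euc d)
      map_add' := fun f g => map_add _ f g
      map_smul' := fun c f => by simp }
  exact ⟨LinearMap.toContinuousLinearMap S, fun v => rfl⟩

lemma isC1Field_of_mem_gradientFields (hX : IsC2ConvexBody X) {Q : X → Euc d}
    (hQ : Q ∈ gradientFields X) : IsC1Field X Q := by
  obtain ⟨f, hf, hfQ⟩ := hQ
  obtain ⟨T, hT⟩ := exists_riesz_map d
  have h1 : ContDiffOn ℝ 1 (fun x => -T (fderivWithin ℝ f X x)) X :=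
    (T.contDiff.comp_contDiffOn (hf.fderivWithin hX.uniqueDiffOn (by norm_num))).neg
  refine h1.congr fun x hx => ?_
  rw [extendField_of_mem _ hx,
    (hfQ ⟨x, hx⟩).hasFDerivWithinAt.fderivWithin (hX.uniqueDiffOn x hx)]
  refine ext_inner_right ℝ fun w => ?_
  rw [inner_neg_left, hT, InnerProductSpace.toDual_apply_apply, inner_neg_left, neg_neg]

/-- Closedness requires a potential for the limit field. Potentials normalised to vanish at `x₀`
converge pointwise by the mean value inequality, since their gradients converge uniformly; the limit
`F` has gradient `-g`, and it is `C²` because `g` is `C¹`. -/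
theorem isCompleteC1Class_gradientFields (hX : IsC2ConvexBody X) :
    IsCompleteC1Class X (gradientFields X) := by
  obtain ⟨S, hS⟩ := exists_dual_map d
  refine isCompleteC1Class_of_closed hX _ (fun Q h => isC1Field_of_mem_gradientFields hX h)
    (fun u => ?_) fun R g hg hR => ?_
  · refine ⟨⟨fun _ => u, fun x => S (-u) x, (S (-u)).contDiff.contDiffOn, fun x => ?_⟩,
      fun _ => rfl⟩
    rw [hasGradientWithinAt_iff_hasFDerivWithinAt, ← hS]
    exact (S (-u)).hasFDerivWithinAt
  · obtain ⟨x₀, hx₀⟩ := hX.interior_nonempty.mono interior_subset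
    have hmem := fun n => (R n).2
    choose f hf hfR using hmem
    have hder : ∀ n, ∀ x ∈ X, HasFDerivWithinAt (fun x => f n x - f n x₀)
        (S (-extendField X (R n) x)) X x := by
      intro n x hx
      rw [hS, extendField_of_mem _ hx]
      exact (hfR n ⟨x, hx⟩).hasFDerivWithinAt.sub_const _
    have hunif : ∀ ε > 0, ∀ᶠ n in atTop, ∀ x ∈ X,
        ‖S (-extendField X (R n) x) - S (-extendField X g x)‖ ≤ ε := by
      intro ε hε
      have hpos : 0 < ε / (‖S‖ + 1) := by positivity
      filter_upwards [Metric.tendstoUniformly_iff.1 hR _ hpos] with n hn x hx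
      rw [← map_sub, extendField_of_mem _ hx, extendField_of_mem _ hx]
      have h1 := (hn ⟨x, hx⟩).le
      rw [dist_eq_norm] at h1
      have h2 : ‖-(R n : X → Euc d) ⟨x, hx⟩ - -g ⟨x, hx⟩‖ ≤ ε / (‖S‖ + 1) := by
        rwa [neg_sub_neg]
      calc _ ≤ ‖S‖ * ‖-(R n : X → Euc d) ⟨x, hx⟩ - -g ⟨x, hx⟩‖ := S.le_opNorm _
        _ ≤ (‖S‖ + 1) * (ε / (‖S‖ + 1)) :=
          mul_le_mul (by linarith) h2 (norm_nonneg _) (by positivity)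
        _ = ε := by field_simp
    have hlim : ∀ x ∈ X, ∃ y, Tendsto (fun n => f n x - f n x₀) atTop (𝓝 y) := by
      intro x hx
      refine cauchySeq_tendsto_of_complete (Metric.cauchySeq_iff'.2 fun ε hε => ?_)
      -- Two such errors over the distance `‖x - x₀‖` add up to less than `ε`; the `+ 1` covers `x =
      -- x₀`.
      have hpos : 0 < ε / (4 * (‖x - x₀‖ + 1)) := by positivity
      obtain ⟨N, hN⟩ := eventually_atTop.1 (hunif _ hpos)
      refine ⟨N, fun n hn => ?_⟩
      have h1 := hX.convex.norm_image_sub_le_of_norm_hasFDerivWithin_le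
        (f := fun z => (f n z - f n x₀) - (f N z - f N x₀))
        (C := ε / (4 * (‖x - x₀‖ + 1)) + ε / (4 * (‖x - x₀‖ + 1)))
        (fun z hz => (hder n z hz).sub (hder N z hz)) (fun z hz => by
          refine (norm_sub_le_norm_sub_add_norm_sub _ (S (-extendField X g z)) _).trans ?_
          have := hN N le_rfl z hz
          rw [norm_sub_rev] at this
          exact add_le_add (hN n hn z hz) this) hx₀ hx
      simp only [sub_self, sub_zero] at h1
      rw [dist_eq_norm]
      refine h1.trans_lt ?_
      have e : ε / (4 * (‖x - x₀‖ + 1)) + ε / (4 * (‖x - x₀‖ + 1)) =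
        ε / 2 / (‖x - x₀‖ + 1) := by field_simp; norm_num
      rw [e, div_mul_eq_mul_div, div_lt_iff₀ (by positivity)]
      nlinarith [norm_nonneg (x - x₀)]
    choose! F hF using hlim
    have hFd : ∀ x ∈ X, HasFDerivWithinAt F (S (-extendField X g x)) X x := fun x hx =>
      hasFDerivWithinAt_of_tendsto hX.convex (g' := fun x => S (-extendField X g x)) hder hF
        hunif hx
    refine ⟨F, ?_, fun x => ?_⟩
    · have h1 := contDiffOn_succ_iff_fderivWithin (n := 1) (f := F) hX.uniqueDiffOn
      rw [one_add_one_eq_two] at h1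
      refine h1.2 ⟨fun x hx => (hFd x hx).differentiableWithinAt, by simp, ?_⟩
      exact (S.contDiff.comp_contDiffOn (ContDiffOn.neg hg)).congr fun x hx =>
        (hFd x hx).fderivWithin (hX.uniqueDiffOn x hx)
    · rw [hasGradientWithinAt_iff_hasFDerivWithinAt, ← hS]
      have := hFd x x.2
      rwa [extendField_apply] at this

end Examples

theorem prevalent_of_isLinearMap {d : ℕ} {X : Set (Euc d)} (hX : IsC2ConvexBody X) {𝒬 : Type*}
    [AddCommGroup 𝒬] [Module ℝ 𝒬] {ev : 𝒬 → X → Euc d} (hev : ∀ Q, IsC1Field X (ev Q))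
    (hlin : IsLinearMap ℝ ev) (hconst : ContainsConstants X ev) :
    Prevalent {Q : 𝒬 | HasFinitelyManyRTS X (ev Q)} := by
  obtain ⟨P, hP, h⟩ := exists_isSubmersionProbe hX hlin hev hconst
  exact prevalent_of_isSubmersionProbe hX hev h

end DynSolver

open DynSolver
theorem mainTheorem2 {d : ℕ} (X : Set (Euc d)) (hX : IsC2ConvexBody X) :
    -- an arbitrary complete metric vector space `𝒬` of `C¹` fields `ev Q : X → ℝᵈ`
    (∀ (𝒬 : Type*) [AddCommGroup 𝒬] [Module ℝ 𝒬] (m : MetricSpace 𝒬) (ev : 𝒬 → X → Euc d),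
      IsCompleteMetricVectorSpace 𝒬 m → (∀ Q : 𝒬, IsC1Field X (ev Q)) →
        -- every field induces a dynamic solver
        (∀ Q : 𝒬, WellBehaved X (ev Q)) ∧
        -- prevalence from a submersion probe
        ((∃ (P : Submodule ℝ 𝒬) (_ : FiniteDimensional ℝ P), IsSubmersionProbe X ev P) →
          Prevalent {Q : 𝒬 | HasFinitelyManyRTS X (ev Q)}) ∧
        -- the case that the vector space operations of `𝒬` are the pointwise ones
        (IsLinearMap ℝ ev →
          (∀ (P : Submodule ℝ 𝒬) [FiniteDimensional ℝ P],
            EvalIsSubmersion X ev P → IsSubmersionProbe X ev P) ∧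
          (ContainsConstants X ev →
            (∃ (P : Submodule ℝ 𝒬) (_ : FiniteDimensional ℝ P), IsSubmersionProbe X ev P) ∧
            Prevalent {Q : 𝒬 | HasFinitelyManyRTS X (ev Q)}))) ∧
    -- projected gradient flows
    (IsCompleteC1Class X (gradientFields X) ∧
      Prevalent {Q : gradientFields X | HasFinitelyManyRTS X (Q : X → Euc d)}) ∧
    -- projected Picard flows
    (IsCompleteC1Class X (picardFields X) ∧
      Prevalent {Q : picardFields X | HasFinitelyManyRTS X (Q : X → Euc d)}) := by
  refine ⟨fun 𝒬 _ _ m ev _ hev => ⟨fun Q => (hev Q).wellBehaved hX, ?_, fun hlin =>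
    ⟨fun P _ hP => isSubmersionProbe_of_evalIsSubmersion hX hlin hev P hP, fun hconst =>
      ⟨exists_isSubmersionProbe hX hlin hev hconst,
        prevalent_of_isLinearMap hX hev hlin hconst⟩⟩⟩, ?_, ?_⟩
  · rintro ⟨P, hP, h⟩
    exact prevalent_of_isSubmersionProbe hX hev h
  · have h := isCompleteC1Class_gradientFields hX
    exact ⟨h, prevalent_of_isLinearMap hX (fun Q => h.1 _ Q.2) ⟨fun _ _ => rfl, fun _ _ => rfl⟩ h.2.2⟩
  · have h := isCompleteC1Class_picardFields hX
    exact ⟨h, prevalent_of_isLinearMap hX (fun Q => h.1 _ Q.2) ⟨fun _ _ => rfl, fun _ _ => rfl⟩ h.2.2⟩
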